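/- Let $N\in\mathbb N$ and $1<p<N$, and set $p^*=\frac{Np}{N-p}$. Let $X=D^{1,p}(\mathbb R^N)$ be the Beppo-Levi space, i.e. the completion of $C_c^\infty(\mathbb R^N)$ under the norm $\|u\|_X=\big(\int_{\mathbb R^N}|\nabla u|^p\,dx\big)^{1/p}$, realized through the Sobolev inequality as a space of functions in $L^{p^*}(\mathbb R^N)$ with gradient in $L^p(\mathbb R^N;\mathbb R^N)$. Let $a:\mathbb R^N\to\mathbb R$ be Lebesgue measurable with $$|a(x)|\le c_a\,w(x)\ \text{ for a.e. } x\in\mathbb R^N,\qquad w(x)=\frac{1}{1+|x|^{N+\alpha}},$$ for some constants $c_a,\alpha>0$. Let $g:\mathbb R^N\times\mathbb R\to\mathbb R$ be a Carathéodory function, i.e. $x\mapsto g(x,s)$ is Lebesgue measurable for every $s\in\mathbb R$ and $s\mapsto g(x,s)$ is continuous for a.e. $x\in\mathbb R^N$. Suppose that for some $c_g>0$ either (Hg1) there is $q$ with $1<q<p$ such that $|g(x,s)|\le c_g\big(1+|s|^{q-1}\big)$ for a.e. $x\in\mathbb R^N$ and all $s\in\mathbb R$; or (Hg2) $|g(x,s)|\le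 c_g\big(1+|s|^{p-1}\big)$ for a.e. $x\in\mathbb R^N$ and all $s\in\mathbb R$, and $c_ac_g<\frac{1}{\|i_w\|^p}$, where $\|i_w\|$ is the norm of the embedding operator $i_w:X\to L^p(\mathbb R^N,w)$ into the weighted Lebesgue space with norm $|u|_{p,w}=\big(\int_{\mathbb R^N}w|u|^p\,dx\big)^{1/p}$. Then the equation $-\Delta_p u=a(x)g(x,u)$ has at least one weak solution in $X$: there is $u\in X$ such that for every $\varphi\in X$ both integrals below exist (their integrands are Lebesgue integrable) and $$\int_{\mathbb R^N}|\nabla u|^{p-2}\nabla u\cdot\nabla\varphi\,dx=\int_{\mathbb R^N}a(x)\,g(x,u)\,\varphi\,dx .$$ -/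

import Mathlib

open MeasureTheory Filter Topology
open scoped ENNReal ContDiff

noncomputable section

/-- The critical Sobolev exponent `p* = N p / (N - p)`. -/
def criticalExponent (N : ℕ) (p : ℝ) : ℝ := N * p / (N - p)

/-- `HasD1pGradient p u V` says that `u` belongs to the Beppo-Levi space `D^{1,p}(ℝ^N)` and that
`V` is its gradient `∇u`.

For `1 < p < N` the space `D^{1,p}(ℝ^N)` is the completion of `C_c^∞(ℝ^N)` under `‖∇φ‖_{L^p}`.
By the Sobolev inequality a sequence in `C_c^∞` that is Cauchy in this norm converges in `L^{p*}`,
so the completion is the space of limits `(u, V)` of pairs `(φ n, ∇(φ n))` in `L^{p*} × L^p`. -/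
structure HasD1pGradient {N : ℕ} (p : ℝ) (u : EuclideanSpace ℝ (Fin N) → ℝ)
    (V : EuclideanSpace ℝ (Fin N) → EuclideanSpace ℝ (Fin N)) : Prop where
  memLp : MemLp u (ENNReal.ofReal (criticalExponent N p)) volume
  memLp_grad : MemLp V (ENNReal.ofReal p) volume
  approx : ∃ φ : ℕ → EuclideanSpace ℝ (Fin N) → ℝ,
    (∀ n, ContDiff ℝ ∞ (φ n) ∧ HasCompactSupport (φ n)) ∧
    Tendsto (fun n => eLpNorm (fun x => φ n x - u x)
      (ENNReal.ofReal (criticalExponent N p)) volume) atTop (𝓝 0) ∧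
    Tendsto (fun n => eLpNorm (fun x => gradient (φ n) x - V x)
      (ENNReal.ofReal p) volume) atTop (𝓝 0)

/-- The weight `w(x) = 1 / (1 + |x|^{N+α})`. -/
def weight (N : ℕ) (α : ℝ) (x : EuclideanSpace ℝ (Fin N)) : ℝ :=
  1 / (1 + ‖x‖ ^ ((N : ℝ) + α))

/-- The measure `w dx`; its `L^r` space is the weighted Lebesgue space `L^r(ℝ^N, w)`, with norm
`(∫ w |u|^r dx)^{1/r}`. -/
def weightMeasure (N : ℕ) (α : ℝ) : Measure (EuclideanSpace ℝ (Fin N)) :=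
  volume.withDensity (fun x => ENNReal.ofReal (weight N α x))

/-- The operator norm `‖i_w‖` of the embedding `i_w : D^{1,p}(ℝ^N) → L^p(ℝ^N, w)`, that is, the
least `C ≥ 0` such that `(∫ w |u|^p)^{1/p} ≤ C (∫ |∇u|^p)^{1/p}` for all `u ∈ D^{1,p}(ℝ^N)`. -/
def weightedEmbeddingNorm (N : ℕ) (p α : ℝ) : ℝ :=
  sInf {C : ℝ | 0 ≤ C ∧ ∀ (u : EuclideanSpace ℝ (Fin N) → ℝ)
    (V : EuclideanSpace ℝ (Fin N) → EuclideanSpace ℝ (Fin N)), HasD1pGradient p u V →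
      eLpNorm u (ENNReal.ofReal p) (weightMeasure N α) ≤
        ENNReal.ofReal C * eLpNorm V (ENNReal.ofReal p) volume}

/-- Carathéodory functions `g : ℝ^N × ℝ → ℝ`: Lebesgue measurable in `x` for every `s`, and
continuous in `s` for almost every `x`. -/
structure IsCaratheodoryFun {N : ℕ} (g : EuclideanSpace ℝ (Fin N) → ℝ → ℝ) : Prop where
  measurable : ∀ s : ℝ, AEMeasurable (fun x => g x s) volume
  continuous : ∀ᵐ x ∂volume, Continuous (g x)

/-- `u ∈ D^{1,p}(ℝ^N)` is a weak solution of `-Δ_p u = f(x, u)`: for every test function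
`φ ∈ D^{1,p}(ℝ^N)` (with gradient `Φ`) both integrals below exist, and
`∫ |∇u|^{p-2} ∇u · ∇φ dx = ∫ f(x, u) φ dx`. -/
def IsWeakPLaplaceSolution {N : ℕ} (p : ℝ) (f : EuclideanSpace ℝ (Fin N) → ℝ → ℝ)
    (u : EuclideanSpace ℝ (Fin N) → ℝ) : Prop :=
  ∃ V : EuclideanSpace ℝ (Fin N) → EuclideanSpace ℝ (Fin N), HasD1pGradient p u V ∧
    ∀ (φ : EuclideanSpace ℝ (Fin N) → ℝ)
      (Φ : EuclideanSpace ℝ (Fin N) → EuclideanSpace ℝ (Fin N)), HasD1pGradient p φ Φ →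
      Integrable (fun x => inner ℝ (‖V x‖ ^ (p - 2) • V x) (Φ x)) volume ∧
      Integrable (fun x => f x (u x) * φ x) volume ∧
      ∫ x, inner ℝ (‖V x‖ ^ (p - 2) • V x) (Φ x) = ∫ x, f x (u x) * φ x

end

/-! ### Convexity of the p-th power of a norm, and comparison of powers. -/

section Inequalities

/-! The proof is the direct method. Put μ = w dx, a finite measure with μ ≤ dx, and h = (a/w) g, so
that |a/w| ≤ c_a and the equation becomes -Δ_p u = h(x, u) μ. With H the primitive of h in s, weak
solutions are critical points of J(u) = (1/p) ∫ |∇u|^p dx - ∫ H(x, u) dμ.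

Coercivity: h is bounded by a constant plus B|s|^(p-1), and both growth hypotheses allow B C^p < 1
for some bound C of the embedding into L^p(μ); under (Hg1) the coefficient B can be made as small as
desired (`exists_growth_constants`, `exists_energy_coercive`).

Existence of a minimizer avoids weak convergence. Take test functions whose energies tend to the
infimum m over all test functions. Their gradients are bounded in L^p, so a subsequence is Cauchy in
L^p(μ) (`exists_subseq_cauchy_eLpNorm`: averages over small balls are uniformly close to the
functions, and for a fixed radius they are equibounded and equi-Lipschitz). The H-term is uniformly
continuous on bounded sets of L^p(μ), so it hardly changes between two late members and their
midpoint. The midpoint has energy at least m, hence the convexity defect of the gradient terms tends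
to 0, and uniform convexity (`exists_norm_sub_rpow_le_midpoint_defect`) makes the gradients Cauchy
in L^p. The strong limit lies in D^{1,p}, has energy m, and minimizes J on the whole space by
density.

Differentiating J(u + tφ) at t = 0 under the integral signs gives the equation
(`eulerLagrange_of_minimizer`). -/

theorem norm_rpow_midpoint_lt {E : Type*} [NormedAddCommGroup E] [InnerProductSpace ℝ E]
    {p : ℝ} (hp : 1 < p) {a b : E} (hab : a ≠ b) :
    ‖(1 / 2 : ℝ) • (a + b)‖ ^ p < (‖a‖ ^ p + ‖b‖ ^ p) / 2 := by
  have hsc := strictConvexOn_rpow hp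
  have hle : ‖(1 / 2 : ℝ) • (a + b)‖ ≤ (‖a‖ + ‖b‖) / 2 := by
    rw [norm_smul]; norm_num; linarith [norm_add_le a b]
  -- Strictness has two sources: for equal norms the triangle inequality is strict, since distinct
  -- vectors of equal norm are not on a common ray; for different norms t ↦ t ^ p is strictly
  -- convex.
  by_cases hn : ‖a‖ = ‖b‖
  · have hlt : ‖(1 / 2 : ℝ) • (a + b)‖ < ‖b‖ := by
      have h1 : ‖a + b‖ < ‖a‖ + ‖b‖ := by
        refine norm_add_lt_of_not_sameRay fun h => hab ?_
        exact (sameRay_iff_of_norm_eq hn).1 h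
      rw [norm_smul]; norm_num; linarith
    have := Real.rpow_lt_rpow (norm_nonneg _) hlt (by linarith : 0 < p)
    rw [hn]; linarith
  · have h2 := hsc.2 (Set.mem_Ici.2 (norm_nonneg a)) (Set.mem_Ici.2 (norm_nonneg b)) hn
      (by norm_num : (0 : ℝ) < 1 / 2) (by norm_num : (0 : ℝ) < 1 / 2) (by norm_num)
    simp only [smul_eq_mul] at h2
    calc ‖(1 / 2 : ℝ) • (a + b)‖ ^ p ≤ ((‖a‖ + ‖b‖) / 2) ^ p :=
          Real.rpow_le_rpow (norm_nonneg _) hle (by linarith)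
      _ = (1 / 2 * ‖a‖ + 1 / 2 * ‖b‖) ^ p := by ring_nf
      _ < _ := h2
      _ = _ := by ring

theorem norm_rpow_midpoint_le {E : Type*} [NormedAddCommGroup E] [InnerProductSpace ℝ E]
    {p : ℝ} (hp : 1 < p) (a b : E) :
    ‖(1 / 2 : ℝ) • (a + b)‖ ^ p ≤ (‖a‖ ^ p + ‖b‖ ^ p) / 2 := by
  rcases eq_or_ne a b with rfl | h
  · have : (1 / 2 : ℝ) • (a + a) = a := by rw [← two_smul ℝ a, smul_smul]; norm_num
    rw [this]; linarith
  · exact (norm_rpow_midpoint_lt hp h).le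

/-- A quantitative form of the uniform convexity of `‖·‖ ^ p`. -/
theorem exists_norm_sub_rpow_le_midpoint_defect (E : Type*) [NormedAddCommGroup E]
    [InnerProductSpace ℝ E] [FiniteDimensional ℝ E] {p : ℝ} (hp : 1 < p) {ε : ℝ} (hε : 0 < ε) :
    ∃ K : ℝ, 0 ≤ K ∧ ∀ a b : E, ‖a - b‖ ^ p ≤ ε * (‖a‖ ^ p + ‖b‖ ^ p) +
      K * ((‖a‖ ^ p + ‖b‖ ^ p) / 2 - ‖(1 / 2 : ℝ) • (a + b)‖ ^ p) := by
  have hp0 : 0 < p := by linarith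
  have hrp : Continuous fun t : ℝ => t ^ p := Real.continuous_rpow_const hp0.le
  -- T is the part of the unit sphere where the ε-term alone does not give the strict bound. It is
  -- compact and misses the diagonal, so the defect is bounded below on it by some δ > 0; the factor
  -- 2 ^ p / δ then works because ‖a - b‖ ≤ 2 there.
  set T : Set (E × E) := Metric.sphere 0 1 ∩
    {x | ε * (‖x.1‖ ^ p + ‖x.2‖ ^ p) ≤ ‖x.1 - x.2‖ ^ p} with hT
  have hTc : IsCompact T := by
    refine (isCompact_sphere _ _).inter_right (isClosed_le ?_ ?_)
    · exact continuous_const.mul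
        ((hrp.comp (by fun_prop)).add (hrp.comp (by fun_prop)))
    · exact hrp.comp (by fun_prop)
  have hpos : ∀ x ∈ T, 0 < (‖x.1‖ ^ p + ‖x.2‖ ^ p) / 2 - ‖(1 / 2 : ℝ) • (x.1 + x.2)‖ ^ p := by
    rintro ⟨a, b⟩ ⟨h1, h2⟩
    refine sub_pos.2 (norm_rpow_midpoint_lt hp ?_)
    intro hab
    obtain rfl : a = b := hab
    simp only [Set.mem_ofPred_eq, sub_self, norm_zero, Real.zero_rpow hp0.ne'] at h2
    have h3 : ‖a‖ = 1 := by simpa [Prod.norm_def] using h1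
    rw [h3] at h2
    norm_num at h2
    linarith
  obtain ⟨δ, hδ, hδT⟩ := hTc.exists_forall_le' (a := 0) (f := fun x : E × E =>
    (‖x.1‖ ^ p + ‖x.2‖ ^ p) / 2 - ‖(1 / 2 : ℝ) • (x.1 + x.2)‖ ^ p) (by
      refine Continuous.continuousOn ?_
      exact (((hrp.comp (by fun_prop)).add (hrp.comp (by fun_prop))).div_const _).sub
        (hrp.comp (by fun_prop))) hpos
  have key : ∀ a b : E, ‖(a, b)‖ = 1 → ‖a - b‖ ^ p ≤ ε * (‖a‖ ^ p + ‖b‖ ^ p) +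
      2 ^ p / δ * ((‖a‖ ^ p + ‖b‖ ^ p) / 2 - ‖(1 / 2 : ℝ) • (a + b)‖ ^ p) := by
    intro a b hab
    have hd := sub_nonneg.2 (norm_rpow_midpoint_le hp a b)
    have hs : 0 ≤ ε * (‖a‖ ^ p + ‖b‖ ^ p) := by positivity
    by_cases h : (a, b) ∈ T
    · have h1 := hδT _ h
      simp only at h1
      have h2 : ‖a - b‖ ^ p ≤ 2 ^ p := by
        refine Real.rpow_le_rpow (norm_nonneg _) ?_ hp0.le
        have ha : ‖a‖ ≤ 1 := hab ▸ norm_fst_le (a, b)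
        have hb : ‖b‖ ≤ 1 := hab ▸ norm_snd_le (a, b)
        linarith [norm_sub_le a b]
      have h3 : (2 : ℝ) ^ p ≤ 2 ^ p / δ *
          ((‖a‖ ^ p + ‖b‖ ^ p) / 2 - ‖(1 / 2 : ℝ) • (a + b)‖ ^ p) := by
        rw [div_mul_eq_mul_div, le_div_iff₀ hδ]
        exact mul_le_mul_of_nonneg_left h1 (by positivity)
      linarith
    · have h1 : ‖a - b‖ ^ p < ε * (‖a‖ ^ p + ‖b‖ ^ p) := by
        by_contra hcon
        exact h ⟨by simpa using hab, not_lt.1 hcon⟩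
      have : 0 ≤ 2 ^ p / δ * ((‖a‖ ^ p + ‖b‖ ^ p) / 2 - ‖(1 / 2 : ℝ) • (a + b)‖ ^ p) := by
        positivity
      linarith
  refine ⟨2 ^ p / δ, by positivity, fun a b => ?_⟩
  by_cases h0 : (a, b) = 0
  · obtain ⟨rfl, rfl⟩ := Prod.mk_eq_zero.1 h0
    simp [Real.zero_rpow hp0.ne']
  -- All terms are homogeneous of degree p, so the estimate on the sphere suffices.
  set r := ‖(a, b)‖ with hr
  have hr0 : 0 < r := norm_pos_iff.2 h0
  have hk := key (r⁻¹ • a) (r⁻¹ • b) (by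
    rw [← Prod.smul_mk, norm_smul, ← hr]; simp [abs_of_pos hr0, hr0.ne'])
  rw [← smul_sub, ← smul_add, smul_comm] at hk
  simp only [norm_smul r⁻¹, norm_inv, Real.norm_of_nonneg hr0.le] at hk
  simp only [Real.mul_rpow (inv_nonneg.2 hr0.le) (norm_nonneg _)] at hk
  have hc : 0 < r⁻¹ ^ p := by positivity
  refine le_of_mul_le_mul_left ?_ hc
  linarith

/-- The threshold T solves η T^(s-r) = 1: above it the higher power dominates, below it t^r ≤ T^r.
This absorbs lower-order growth into an arbitrarily small multiple of the leading power. -/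
theorem exists_rpow_le_add_mul_rpow {r s : ℝ} (hr : 0 < r) (hrs : r < s) {η : ℝ} (hη : 0 < η) :
    ∃ C : ℝ, 0 ≤ C ∧ ∀ t : ℝ, 0 ≤ t → t ^ r ≤ C + η * t ^ s := by
  set T : ℝ := η⁻¹ ^ (s - r)⁻¹ with hT
  have hsr : 0 < s - r := by linarith
  have hT0 : 0 < T := by positivity
  refine ⟨T ^ r, by positivity, fun t ht => ?_⟩
  rcases le_total t T with h | h
  · have : 0 ≤ η * t ^ s := by positivity
    linarith [Real.rpow_le_rpow ht h hr.le]
  · have ht0 : 0 < t := hT0.trans_le h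
    have h1 : η⁻¹ ≤ t ^ (s - r) := by
      calc η⁻¹ = T ^ (s - r) := by
            rw [hT, ← Real.rpow_mul (by positivity), inv_mul_cancel₀ hsr.ne', Real.rpow_one]
        _ ≤ _ := Real.rpow_le_rpow hT0.le h hsr.le
    have h2 : t ^ s = t ^ r * t ^ (s - r) := by rw [← Real.rpow_add ht0]; ring_nf
    have h3 : 1 ≤ η * t ^ (s - r) := by
      rw [inv_le_iff_one_le_mul₀ hη] at h1; linarith
    have h4 : 0 ≤ T ^ r := by positivity
    have h5 : 0 ≤ t ^ r := by positivity
    rw [h2]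
    nlinarith

end Inequalities

/-! ### Superposition operators: the primitive as a functional on L^p of a finite measure. -/

noncomputable section Nemytskii

/-- Jointly measurable nonlinearities, continuous in the second variable, of growth `p - 1`. -/
structure HasGrowth {X : Type*} [MeasurableSpace X] (h : X → ℝ → ℝ) (p A B : ℝ) : Prop where
  measurable : Measurable (Function.uncurry h)
  continuous : ∀ x, Continuous (h x)
  nonneg_left : 0 ≤ A
  nonneg_right : 0 ≤ B
  abs_le : ∀ x s, |h x s| ≤ A + B * |s| ^ (p - 1)

/-- The primitive `∫ t in 0..s, h x t` of a nonlinearity. -/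
def primitive {X : Type*} (h : X → ℝ → ℝ) (x : X) (s : ℝ) : ℝ := ∫ t in (0 : ℝ)..s, h x t

theorem abs_integral_le_of_growth {k : ℝ → ℝ} (hk : Continuous k) {p A B : ℝ} (hp : 1 < p)
    (hb : ∀ t, |k t| ≤ A + B * |t| ^ (p - 1)) {s : ℝ} (hs : 0 ≤ s) :
    |∫ t in (0 : ℝ)..s, k t| ≤ A * s + B / p * s ^ p := by
  have hc : Continuous fun t : ℝ => B * t ^ (p - 1) :=
    continuous_const.mul (Real.continuous_rpow_const (by linarith))
  calc |∫ t in (0 : ℝ)..s, k t| ≤ ∫ t in (0 : ℝ)..s, |k t| :=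
        intervalIntegral.abs_integral_le_integral_abs hs
    _ ≤ ∫ t in (0 : ℝ)..s, (A + B * t ^ (p - 1)) := by
        refine intervalIntegral.integral_mono_on hs (hk.abs.intervalIntegrable _ _)
          ((continuous_const.add hc).intervalIntegrable _ _) ?_
        intro t ht
        have := hb t
        rwa [abs_of_nonneg ht.1] at this
    _ = A * s + B / p * s ^ p := by
        rw [intervalIntegral.integral_add (continuous_const.intervalIntegrable _ _)
          (hc.intervalIntegrable _ _), intervalIntegral.integral_const_mul, integral_rpow (Or.inl (by linarith))]
        simp only [intervalIntegral.integral_const, sub_zero, smul_eq_mul, sub_add_cancel]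
        rw [Real.zero_rpow (by linarith)]
        ring

namespace HasGrowth

variable {X : Type*} [MeasurableSpace X] {h : X → ℝ → ℝ} {p A B : ℝ}

theorem hasDerivAt_primitive (hh : HasGrowth h p A B) (x : X) (s : ℝ) :
    HasDerivAt (primitive h x) (h x s) s :=
  ((hh.continuous x).integral_hasStrictDerivAt 0 s).hasDerivAt

theorem abs_primitive_le (hh : HasGrowth h p A B) (hp : 1 < p) (x : X) (s : ℝ) :
    |primitive h x s| ≤ A * |s| + B / p * |s| ^ p := by
  rcases le_total 0 s with hs | hs
  · rw [abs_of_nonneg hs]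
    exact abs_integral_le_of_growth (hh.continuous x) hp (hh.abs_le x) hs
  · rw [abs_of_nonpos hs]
    have h1 := abs_integral_le_of_growth (k := fun t => h x (-t))
      ((hh.continuous x).comp continuous_neg) hp (fun t => by simpa using hh.abs_le x (-t))
      (neg_nonneg.2 hs)
    rw [intervalIntegral.integral_comp_neg, neg_neg, neg_zero,
      intervalIntegral.integral_symm, abs_neg] at h1
    exact h1

theorem measurable_primitive (hh : HasGrowth h p A B) {u : X → ℝ} (hu : Measurable u) :
    Measurable fun x => primitive h x (u x) := by
  -- Rescaling to a fixed interval turns the variable endpoint into a parameter of the integrand, so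
  -- that measurability of parametric integrals applies.
  have h1 : ∀ x, primitive h x (u x) = u x * ∫ θ in Set.Ioc (0 : ℝ) 1, h x (u x * θ) := by
    intro x
    have := intervalIntegral.mul_integral_comp_mul_left (f := h x) (a := 0) (b := 1) (u x)
    rw [intervalIntegral.integral_of_le zero_le_one] at this
    rw [this, mul_zero, mul_one]
    rfl
  simp_rw [h1]
  refine hu.mul ?_
  refine (StronglyMeasurable.integral_prod_right (f := fun x θ => h x (u x * θ)) ?_).measurable
  exact (hh.measurable.comp (measurable_fst.prodMk
    ((hu.comp measurable_fst).mul measurable_snd))).stronglyMeasurable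

theorem aemeasurable_comp {μ : Measure X} (hh : HasGrowth h p A B) {u : X → ℝ}
    (hu : AEMeasurable u μ) : AEMeasurable (fun x => h x (u x)) μ :=
  hh.measurable.comp_aemeasurable (aemeasurable_id.prodMk hu)

theorem aemeasurable_primitive {μ : Measure X} (hh : HasGrowth h p A B) {u : X → ℝ}
    (hu : AEMeasurable u μ) : AEMeasurable (fun x => primitive h x (u x)) μ :=
  ⟨_, hh.measurable_primitive hu.measurable_mk, by
    filter_upwards [hu.ae_eq_mk] with x hx; rw [hx]⟩

theorem abs_primitive_sub_le (hh : HasGrowth h p A B) (hp : 1 < p) (x : X) (s t : ℝ) :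
    |primitive h x s - primitive h x t| ≤
      (A + B) * (1 + |s| + |t|) ^ (p - 1) * |s - t| := by
  have h1 : primitive h x s - primitive h x t = ∫ r in t..s, h x r :=
    intervalIntegral.integral_interval_sub_left ((hh.continuous x).intervalIntegrable _ _)
      ((hh.continuous x).intervalIntegrable _ _)
  rw [h1, ← Real.norm_eq_abs (∫ r in t..s, h x r)]
  refine intervalIntegral.norm_integral_le_of_norm_le_const fun r hr => ?_
  have hr' : |r| ≤ 1 + |s| + |t| := by
    rcases Set.mem_uIoc.1 hr with ⟨h2, h3⟩ | ⟨h2, h3⟩ <;> rw [_root_.abs_le] <;> constructor <;>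
      linarith [neg_abs_le s, neg_abs_le t, le_abs_self s, le_abs_self t,
        abs_nonneg s, abs_nonneg t]
  have hM : 1 ≤ 1 + |s| + |t| := by linarith [abs_nonneg s, abs_nonneg t]
  have h2 : |r| ^ (p - 1) ≤ (1 + |s| + |t|) ^ (p - 1) :=
    Real.rpow_le_rpow (abs_nonneg _) hr' (by linarith)
  have h3 : 1 ≤ (1 + |s| + |t|) ^ (p - 1) := Real.one_le_rpow hM (by linarith)
  calc ‖h x r‖ ≤ A + B * |r| ^ (p - 1) := hh.abs_le x r
    _ ≤ A * (1 + |s| + |t|) ^ (p - 1) + B * (1 + |s| + |t|) ^ (p - 1) := by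
        gcongr
        · exact le_mul_of_one_le_right hh.nonneg_left h3
        · exact hh.nonneg_right
    _ = _ := by ring

/-- A Young-type splitting of M^(p-1)|s - t| with M = 1 + |s| + |t|: if |s - t| ≤ εM the product is
at most εM^p, otherwise M ≤ |s - t|/ε. After integration the first term is ε times a bounded
quantity and the second is controlled by the L^p distance. -/
theorem abs_primitive_sub_le_add (hh : HasGrowth h p A B) (hp : 1 < p) {ε : ℝ} (hε : 0 < ε)
    (x : X) (s t : ℝ) :
    |primitive h x s - primitive h x t| ≤
      (A + B) * (ε * (3 ^ p * (1 + |s| ^ p + |t| ^ p)) + (ε⁻¹) ^ (p - 1) * |s - t| ^ p) := by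
  have hAB : 0 ≤ A + B := add_nonneg hh.nonneg_left hh.nonneg_right
  refine (hh.abs_primitive_sub_le hp x s t).trans ?_
  rw [mul_assoc]
  refine mul_le_mul_of_nonneg_left ?_ hAB
  set M := 1 + |s| + |t| with hM
  have hM1 : 1 ≤ M := by rw [hM]; linarith [abs_nonneg s, abs_nonneg t]
  have hM0 : 0 < M := by linarith
  have hMp : M ^ p ≤ 3 ^ p * (1 + |s| ^ p + |t| ^ p) := by
    have h1 : M ≤ 3 * max 1 (max |s| |t|) := by
      have h2 := le_max_left 1 (max |s| |t|)
      have h3 := le_max_right 1 (max |s| |t|)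
      have h4 := le_max_left |s| |t|
      have h5 := le_max_right |s| |t|
      linarith
    have hm : 0 ≤ max 1 (max |s| |t|) := by positivity
    calc M ^ p ≤ (3 * max 1 (max |s| |t|)) ^ p := Real.rpow_le_rpow hM0.le h1 (by linarith)
      _ = 3 ^ p * (max 1 (max |s| |t|)) ^ p := Real.mul_rpow (by norm_num) hm
      _ ≤ _ := by
        refine mul_le_mul_of_nonneg_left ?_ (by positivity)
        have hs : 0 ≤ |s| ^ p := by positivity
        have ht : 0 ≤ |t| ^ p := by positivity
        rcases max_choice 1 (max |s| |t|) with h | h <;> rw [h]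
        · rw [Real.one_rpow]; linarith
        · rcases max_choice |s| |t| with h | h <;> rw [h] <;> linarith
  have hd := abs_nonneg (s - t)
  have hMp1 : M ^ (p - 1) * M = M ^ p := by
    rw [← Real.rpow_add_one hM0.ne']; ring_nf
  rcases le_total |s - t| (ε * M) with hle | hle
  · have h1 : M ^ (p - 1) * |s - t| ≤ M ^ (p - 1) * (ε * M) :=
      mul_le_mul_of_nonneg_left hle (by positivity)
    have h2 : M ^ (p - 1) * (ε * M) = ε * M ^ p := by rw [← hMp1]; ring
    have h3 : 0 ≤ (ε⁻¹) ^ (p - 1) * |s - t| ^ p := by positivity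
    have h4 := mul_le_mul_of_nonneg_left hMp hε.le
    linarith
  · have h1 : M ≤ ε⁻¹ * |s - t| := by rwa [inv_mul_eq_div, le_div_iff₀' hε]
    have hd0 : 0 < |s - t| := lt_of_lt_of_le (by positivity) hle
    have h2 : M ^ (p - 1) ≤ (ε⁻¹) ^ (p - 1) * |s - t| ^ (p - 1) := by
      rw [← Real.mul_rpow (by positivity) hd]
      exact Real.rpow_le_rpow hM0.le h1 (by linarith)
    have h3 : |s - t| ^ (p - 1) * |s - t| = |s - t| ^ p := by
      rw [← Real.rpow_add_one hd0.ne']; ring_nf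
    have h4 : M ^ (p - 1) * |s - t| ≤ (ε⁻¹) ^ (p - 1) * |s - t| ^ p := by
      rw [← h3, ← mul_assoc]
      exact mul_le_mul_of_nonneg_right h2 hd
    have h5 : 0 ≤ ε * (3 ^ p * (1 + |s| ^ p + |t| ^ p)) := by positivity
    linarith

end HasGrowth

section Integrals

variable {X E : Type*} [MeasurableSpace X] {μ : Measure X} [NormedAddCommGroup E] {p : ℝ}

theorem MeasureTheory.MemLp.integrable_norm_rpow_ofReal (hp : 0 < p) {f : X → E}
    (hf : MemLp f (ENNReal.ofReal p) μ) : Integrable (fun x => ‖f x‖ ^ p) μ := by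
  have := hf.integrable_norm_rpow (by simpa using hp) ENNReal.ofReal_ne_top
  rwa [ENNReal.toReal_ofReal hp.le] at this

theorem eLpNorm_ofReal_rpow_eq (hp : 0 < p) {f : X → E} (hf : MemLp f (ENNReal.ofReal p) μ) :
    eLpNorm f (ENNReal.ofReal p) μ ^ p = ENNReal.ofReal (∫ x, ‖f x‖ ^ p ∂μ) := by
  rw [hf.eLpNorm_eq_integral_rpow_norm (by simpa using hp) ENNReal.ofReal_ne_top,
    ENNReal.toReal_ofReal hp.le, ENNReal.ofReal_rpow_of_nonneg (by positivity) hp.le,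
    ← Real.rpow_mul (by positivity), inv_mul_cancel₀ hp.ne', Real.rpow_one]

theorem integral_norm_rpow_eq (hp : 0 < p) {f : X → E} (hf : MemLp f (ENNReal.ofReal p) μ) :
    ∫ x, ‖f x‖ ^ p ∂μ = (eLpNorm f (ENNReal.ofReal p) μ).toReal ^ p := by
  rw [ENNReal.toReal_rpow, eLpNorm_ofReal_rpow_eq hp hf, ENNReal.toReal_ofReal (by positivity)]

theorem tendsto_eLpNorm_of_tendsto_sub {q : ℝ≥0∞} (hq : 1 ≤ q) {ι : Type*} {l : Filter ι}
    {f : ι → X → E} {g : X → E} (hf : ∀ n, AEStronglyMeasurable (f n) μ) (hg : MemLp g q μ)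
    (h : Tendsto (fun n => eLpNorm (fun x => f n x - g x) q μ) l (𝓝 0)) :
    Tendsto (fun n => eLpNorm (f n) q μ) l (𝓝 (eLpNorm g q μ)) := by
  have hu : ∀ n, eLpNorm (f n) q μ ≤ eLpNorm g q μ + eLpNorm (fun x => f n x - g x) q μ := by
    intro n
    have := eLpNorm_add_le hg.1 ((hf n).sub hg.1) hq
    rwa [add_sub_cancel] at this
  have hl : ∀ n, eLpNorm g q μ - eLpNorm (fun x => f n x - g x) q μ ≤ eLpNorm (f n) q μ := by
    intro n
    rw [tsub_le_iff_right]
    have := eLpNorm_sub_le (hf n) ((hf n).sub hg.1) hq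
    rwa [sub_sub_cancel] at this
  refine tendsto_of_tendsto_of_tendsto_of_le_of_le ?_ ?_ hl hu
  · simpa using ENNReal.Tendsto.sub (tendsto_const_nhds (x := eLpNorm g q μ)) h
      (Or.inl hg.2.ne)
  · simpa using (tendsto_const_nhds (x := eLpNorm g q μ)).add h

theorem tendsto_integral_norm_rpow (hp : 1 ≤ p) {ι : Type*} {l : Filter ι}
    {f : ι → X → E} {g : X → E} (hf : ∀ n, MemLp (f n) (ENNReal.ofReal p) μ)
    (hg : MemLp g (ENNReal.ofReal p) μ)
    (h : Tendsto (fun n => eLpNorm (fun x => f n x - g x) (ENNReal.ofReal p) μ) l (𝓝 0)) :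
    Tendsto (fun n => ∫ x, ‖f n x‖ ^ p ∂μ) l (𝓝 (∫ x, ‖g x‖ ^ p ∂μ)) := by
  have hp0 : 0 < p := by linarith
  simp_rw [fun n => integral_norm_rpow_eq hp0 (hf n), integral_norm_rpow_eq hp0 hg]
  refine Tendsto.rpow_const ?_ (Or.inr hp0.le)
  exact (ENNReal.tendsto_toReal hg.2.ne).comp (tendsto_eLpNorm_of_tendsto_sub
    (by simpa using hp) (fun n => (hf n).1) hg h)

theorem tendsto_integral_norm_sub_rpow (hp : 1 ≤ p) {ι : Type*} {l : Filter ι}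
    {f : ι → X → E} {g : X → E} (hf : ∀ n, MemLp (f n) (ENNReal.ofReal p) μ)
    (hg : MemLp g (ENNReal.ofReal p) μ)
    (h : Tendsto (fun n => eLpNorm (fun x => f n x - g x) (ENNReal.ofReal p) μ) l (𝓝 0)) :
    Tendsto (fun n => ∫ x, ‖f n x - g x‖ ^ p ∂μ) l (𝓝 0) := by
  have hp0 : 0 < p := by linarith
  have := tendsto_integral_norm_rpow (f := fun n x => f n x - g x) (g := fun _ => (0 : E)) hp
    (fun n => (hf n).sub hg) MemLp.zero' (by simpa using h)
  simpa [Real.zero_rpow hp0.ne'] using this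

end Integrals

namespace HasGrowth

variable {X : Type*} [MeasurableSpace X] {μ : Measure X} [IsFiniteMeasure μ]
  {h : X → ℝ → ℝ} {p A B : ℝ}

theorem integrable_primitive (hh : HasGrowth h p A B) (hp : 1 < p) {u : X → ℝ}
    (hu : MemLp u (ENNReal.ofReal p) μ) : Integrable (fun x => primitive h x (u x)) μ := by
  have h1 : Integrable u μ := hu.integrable (by simpa using hp.le)
  have h2 := hu.integrable_norm_rpow_ofReal (by linarith)
  refine Integrable.mono' ((h1.abs.const_mul A).add (h2.const_mul (B / p)))
    (hh.aemeasurable_primitive hu.1.aemeasurable).aestronglyMeasurable ?_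
  exact Eventually.of_forall fun x => hh.abs_primitive_le hp x (u x)

theorem abs_integral_primitive_sub_le (hh : HasGrowth h p A B) (hp : 1 < p) {ε : ℝ}
    (hε : 0 < ε) {u v : X → ℝ} (hu : MemLp u (ENNReal.ofReal p) μ)
    (hv : MemLp v (ENNReal.ofReal p) μ) :
    |∫ x, primitive h x (u x) ∂μ - ∫ x, primitive h x (v x) ∂μ| ≤
      (A + B) * (ε * (3 ^ p * (μ.real Set.univ + ∫ x, ‖u x‖ ^ p ∂μ + ∫ x, ‖v x‖ ^ p ∂μ)) +
        (ε⁻¹) ^ (p - 1) * ∫ x, ‖u x - v x‖ ^ p ∂μ) := by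
  have hp0 : 0 < p := by linarith
  have iu := hu.integrable_norm_rpow_ofReal hp0
  have iv := hv.integrable_norm_rpow_ofReal hp0
  have iuv := (hu.sub hv).integrable_norm_rpow_ofReal hp0
  simp only [Pi.sub_apply] at iuv
  rw [← integral_sub (hh.integrable_primitive hp hu) (hh.integrable_primitive hp hv)]
  have i1 : Integrable (fun _ : X => (1 : ℝ)) μ := integrable_const 1
  have i3 : Integrable (fun x => 1 + ‖u x‖ ^ p) μ := i1.add iu
  have i2 : Integrable (fun x => 1 + ‖u x‖ ^ p + ‖v x‖ ^ p) μ := i3.add iv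
  refine (abs_integral_le_integral_abs).trans ?_
  refine (integral_mono_of_nonneg (Eventually.of_forall fun _ => abs_nonneg _)
    ((((i2.const_mul (3 ^ p)).const_mul ε).add (iuv.const_mul ((ε⁻¹) ^ (p - 1)))).const_mul
      (A + B)) (Eventually.of_forall fun x =>
        hh.abs_primitive_sub_le_add hp hε x (u x) (v x))).trans_eq ?_
  rw [integral_const_mul, integral_add' ((i2.const_mul _).const_mul _) (iuv.const_mul _),
    integral_const_mul, integral_const_mul, integral_const_mul, integral_add i3 iv,
    integral_add i1 iu]
  simp

/-- Uniform continuity on bounded sets of L^p(μ). Both families may vary, as is needed to compare a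
minimizing sequence with its midpoints. -/
theorem tendsto_integral_primitive_sub (hh : HasGrowth h p A B) (hp : 1 < p) {ι : Type*}
    {l : Filter ι} {f g : ι → X → ℝ} (hf : ∀ n, MemLp (f n) (ENNReal.ofReal p) μ)
    (hg : ∀ n, MemLp (g n) (ENNReal.ofReal p) μ) {R : ℝ}
    (hfR : ∀ᶠ n in l, ∫ x, ‖f n x‖ ^ p ∂μ ≤ R) (hgR : ∀ᶠ n in l, ∫ x, ‖g n x‖ ^ p ∂μ ≤ R)
    (hfg : Tendsto (fun n => ∫ x, ‖f n x - g n x‖ ^ p ∂μ) l (𝓝 0)) :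
    Tendsto (fun n => ∫ x, primitive h x (f n x) ∂μ - ∫ x, primitive h x (g n x) ∂μ) l (𝓝 0) := by
  have hAB : 0 ≤ A + B := add_nonneg hh.nonneg_left hh.nonneg_right
  rw [Metric.tendsto_nhds]
  intro η hη
  -- Q bounds everything that multiplies ε, so ε can be fixed before letting the distance tend to 0.
  set Q := (A + B) * (3 ^ p * (μ.real Set.univ + |R| + |R|)) with hQ
  have hQ0 : 0 ≤ Q := by positivity
  set ε := η / (2 * (Q + 1)) with hεd
  have hε : 0 < ε := by positivity
  have hεQ : ε * Q < η / 2 := by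
    rw [hεd, div_mul_eq_mul_div, div_lt_div_iff₀ (by positivity) (by norm_num)]
    nlinarith
  have t3 : Tendsto (fun n => (A + B) * ((ε⁻¹) ^ (p - 1) * ∫ x, ‖f n x - g n x‖ ^ p ∂μ)) l
      (𝓝 0) := by simpa using (hfg.const_mul ((ε⁻¹) ^ (p - 1))).const_mul (A + B)
  filter_upwards [hfR, hgR, t3.eventually (gt_mem_nhds (half_pos hη))] with n h1 h1' h2
  rw [Real.dist_eq, sub_zero]
  refine (hh.abs_integral_primitive_sub_le hp hε (hf n) (hg n)).trans_lt ?_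
  have h3 : (A + B) * (ε * (3 ^ p *
      (μ.real Set.univ + ∫ x, ‖f n x‖ ^ p ∂μ + ∫ x, ‖g n x‖ ^ p ∂μ))) ≤ ε * Q := by
    rw [hQ, mul_left_comm]
    gcongr
    · exact h1.trans (le_abs_self R)
    · exact h1'.trans (le_abs_self R)
  rw [mul_add]
  linarith

theorem tendsto_integral_primitive (hh : HasGrowth h p A B) (hp : 1 < p) {ι : Type*}
    {l : Filter ι} {f : ι → X → ℝ} {g : X → ℝ} (hf : ∀ n, MemLp (f n) (ENNReal.ofReal p) μ)
    (hg : MemLp g (ENNReal.ofReal p) μ)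
    (hfg : Tendsto (fun n => eLpNorm (fun x => f n x - g x) (ENNReal.ofReal p) μ) l (𝓝 0)) :
    Tendsto (fun n => ∫ x, primitive h x (f n x) ∂μ) l (𝓝 (∫ x, primitive h x (g x) ∂μ)) := by
  have h1 := (tendsto_integral_norm_rpow hp.le hf hg hfg).eventually
    (gt_mem_nhds (lt_add_one (∫ x, ‖g x‖ ^ p ∂μ)))
  have h2 := hh.tendsto_integral_primitive_sub hp hf (fun _ => hg)
    (h1.mono fun n hn => hn.le) (Eventually.of_forall fun _ => by linarith)
    (tendsto_integral_norm_sub_rpow hp.le hf hg hfg)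
  simpa using h2.add_const (∫ x, primitive h x (g x) ∂μ)

end HasGrowth

end Nemytskii

/-! ### Compactness in L^p of a finite measure, by averaging over small balls. -/

noncomputable section Compactness

/-- Jensen's inequality, from monotonicity of L^p norms in the exponent on a probability space. -/
theorem enorm_integral_rpow_le_lintegral {X F : Type*} [MeasurableSpace X] {ν : Measure X}
    [IsProbabilityMeasure ν] [NormedAddCommGroup F] [NormedSpace ℝ F] {f : X → F}
    (hf : AEStronglyMeasurable f ν) {p : ℝ} (hp : 1 ≤ p) :
    ‖∫ x, f x ∂ν‖ₑ ^ p ≤ ∫⁻ x, ‖f x‖ₑ ^ p ∂ν := by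
  have hp0 : 0 < p := by linarith
  have h1 : ‖∫ x, f x ∂ν‖ₑ ≤ eLpNorm' f p ν := by
    refine (enorm_integral_le_lintegral_enorm f).trans ?_
    have := eLpNorm'_le_eLpNorm'_of_exponent_le zero_lt_one hp ν hf
    simpa [eLpNorm'] using this
  calc ‖∫ x, f x ∂ν‖ₑ ^ p ≤ (eLpNorm' f p ν) ^ p := ENNReal.rpow_le_rpow h1 hp0.le
    _ = _ := by
      rw [eLpNorm', ← ENNReal.rpow_mul, one_div, inv_mul_cancel₀ hp0.ne', ENNReal.rpow_one]

/-- The fundamental theorem of calculus on the segment from x to x + v, followed by Jensen in t. -/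
theorem enorm_sub_rpow_le_lintegral_fderiv {E : Type*} [NormedAddCommGroup E] [NormedSpace ℝ E]
    {φ : E → ℝ} (hφ : ContDiff ℝ 1 φ) {p : ℝ} (hp : 1 ≤ p) (x v : E) :
    ‖φ (x + v) - φ x‖ₑ ^ p ≤
      ‖v‖ₑ ^ p * ∫⁻ t in Set.Ioc (0 : ℝ) 1, ‖fderiv ℝ φ (x + t • v)‖ₑ ^ p := by
  have hp0 : 0 < p := by linarith
  have hd : ∀ t : ℝ, HasDerivAt (fun t : ℝ => φ (x + t • v)) (fderiv ℝ φ (x + t • v) v) t := by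
    intro t
    have h1 : HasDerivAt (fun t : ℝ => x + t • v) v t := by
      simpa using ((hasDerivAt_id t).smul_const v).const_add x
    exact ((hφ.differentiable one_ne_zero _).hasFDerivAt).comp_hasDerivAt t h1
  have hcont : Continuous fun t : ℝ => fderiv ℝ φ (x + t • v) :=
    (hφ.continuous_fderiv one_ne_zero).comp (by fun_prop)
  have hcont' : Continuous fun t : ℝ => fderiv ℝ φ (x + t • v) v := hcont.clm_apply continuous_const
  have hint : ∫ t in (0 : ℝ)..1, fderiv ℝ φ (x + t • v) v = φ (x + v) - φ x := by
    rw [intervalIntegral.integral_eq_sub_of_hasDerivAt (fun t _ => hd t)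
      (hcont'.intervalIntegrable _ _)]
    simp
  have : IsProbabilityMeasure (volume.restrict (Set.Ioc (0 : ℝ) 1)) := ⟨by simp⟩
  rw [← hint, intervalIntegral.integral_of_le zero_le_one]
  refine (enorm_integral_rpow_le_lintegral hcont'.aestronglyMeasurable hp).trans ?_
  rw [← lintegral_const_mul _ ((hcont.enorm.measurable).pow_const p)]
  refine lintegral_mono fun t => ?_
  rw [← ENNReal.mul_rpow_of_nonneg _ _ hp0.le, mul_comm]
  exact ENNReal.rpow_le_rpow (ContinuousLinearMap.le_opENorm _ _) hp0.le

theorem integrable_translate {E : Type*} [NormedAddCommGroup E] [MeasurableSpace E]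
    [BorelSpace E] {ν : Measure E} [IsFiniteMeasure ν] {φ : E → ℝ} (hφ : Continuous φ) (hc : HasCompactSupport φ) (x : E) :
    Integrable (fun v => φ (x + v)) ν := by
  obtain ⟨C, hC⟩ := hc.exists_bound_of_continuous hφ
  exact (integrable_const C).mono' (hφ.comp (by fun_prop)).aestronglyMeasurable
    (Eventually.of_forall fun v => hC _)

section Average

variable {E : Type*} [NormedAddCommGroup E] [InnerProductSpace ℝ E] [FiniteDimensional ℝ E]
  [MeasurableSpace E] [BorelSpace E]

/-- Normalized Lebesgue measure on the ball. Its density bound K depends on the radius, which is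
harmless: K is only used with the radius fixed. -/
theorem exists_isProbabilityMeasure_ball {ε : ℝ} (hε : 0 < ε) :
    ∃ (ν : Measure E) (K : ℝ≥0∞), IsProbabilityMeasure ν ∧ K ≠ ⊤ ∧ ν ≤ K • volume ∧
      ∀ᵐ v ∂ν, ‖v‖ ≤ ε := by
  have h0 : volume (Metric.ball (0 : E) ε) ≠ 0 := (Metric.measure_ball_pos _ _ hε).ne'
  have h1 : volume (Metric.ball (0 : E) ε) ≠ ⊤ := measure_ball_lt_top.ne
  refine ⟨(volume (Metric.ball (0 : E) ε))⁻¹ • volume.restrict (Metric.ball 0 ε),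
    (volume (Metric.ball (0 : E) ε))⁻¹, ⟨?_⟩, ENNReal.inv_ne_top.2 h0, ?_, ?_⟩
  · simp [ENNReal.inv_mul_cancel h0 h1]
  · gcongr
    exact Measure.restrict_le_self
  · refine Measure.ae_smul_measure ?_ _
    filter_upwards [ae_restrict_mem measurableSet_ball] with v hv
    simpa using (mem_ball_zero_iff.1 hv).le

/-- The average of the translates of `φ` with respect to `ν`. -/
def translateAverage (ν : Measure E) (φ : E → ℝ) (x : E) : ℝ := ∫ v, φ (x + v) ∂ν

theorem lintegral_translate_le {ν : Measure E} {K : ℝ≥0∞} (hK : ν ≤ K • volume) (G : E → ℝ≥0∞) (x : E) :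
    ∫⁻ v, G (v + x) ∂ν ≤ K * ∫⁻ v, G v := by
  refine (lintegral_mono' hK le_rfl).trans ?_
  rw [lintegral_smul_measure, lintegral_add_right_eq_self G x, smul_eq_mul]

variable {ν : Measure E} [IsProbabilityMeasure ν] {φ : E → ℝ} {p : ℝ}

/-- Jensen in v and the segment estimate leave an integral over x, v and t; by Tonelli and
translation invariance the x-integral does not depend on v or t. The error is thus of order ε,
uniformly over functions with bounded gradient norm. -/
theorem lintegral_enorm_translateAverage_sub_rpow_le (hφ : ContDiff ℝ 1 φ)
    (hc : HasCompactSupport φ) (hp : 1 ≤ p) {ε : ℝ} (hν : ∀ᵐ v ∂ν, ‖v‖ ≤ ε) :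
    ∫⁻ x, ‖translateAverage ν φ x - φ x‖ₑ ^ p ≤
      ENNReal.ofReal ε ^ p * ∫⁻ x, ‖fderiv ℝ φ x‖ₑ ^ p := by
  have hp0 : 0 < p := by linarith
  set G : E → ℝ≥0∞ := fun x => ‖fderiv ℝ φ x‖ₑ ^ p with hG
  have hGm : Measurable G := (hφ.continuous_fderiv one_ne_zero).enorm.measurable.pow_const p
  have hpt : ∀ x, ‖translateAverage ν φ x - φ x‖ₑ ^ p ≤
      ENNReal.ofReal ε ^ p * ∫⁻ v, (∫⁻ t in Set.Ioc (0 : ℝ) 1, G (x + t • v)) ∂ν := by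
    intro x
    have h1 : translateAverage ν φ x - φ x = ∫ v, (φ (x + v) - φ x) ∂ν := by
      rw [integral_sub (integrable_translate hφ.continuous hc x) (integrable_const _)]
      simp [translateAverage]
    rw [h1]
    refine (enorm_integral_rpow_le_lintegral (Continuous.aestronglyMeasurable
      ((hφ.continuous.comp (by fun_prop)).sub continuous_const)) hp).trans ?_
    rw [← lintegral_const_mul' _ _ (ENNReal.rpow_ne_top_of_nonneg hp0.le ENNReal.ofReal_ne_top)]
    refine lintegral_mono_ae ?_
    filter_upwards [hν] with v hv
    refine (enorm_sub_rpow_le_lintegral_fderiv hφ hp x v).trans ?_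
    gcongr
    rw [← ofReal_norm]
    exact ENNReal.ofReal_le_ofReal hv
  refine (lintegral_mono hpt).trans ?_
  rw [lintegral_const_mul' _ _ (ENNReal.rpow_ne_top_of_nonneg hp0.le ENNReal.ofReal_ne_top)]
  refine mul_le_mul_right (le_of_eq ?_) _
  have hm3 : Measurable fun z : (E × E) × ℝ => G (z.1.1 + z.2 • z.1.2) :=
    hGm.comp (by fun_prop)
  rw [lintegral_lintegral_swap (Measurable.aemeasurable (Measurable.lintegral_prod_right' hm3))]
  have h2 : ∀ v : E, ∫⁻ x, ∫⁻ t in Set.Ioc (0 : ℝ) 1, G (x + t • v) = ∫⁻ x, G x := by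
    intro v
    have hm2 : Measurable (Function.uncurry fun (x : E) (t : ℝ) => G (x + t • v)) :=
      hGm.comp (by fun_prop)
    rw [lintegral_lintegral_swap hm2.aemeasurable]
    have h3 : ∀ t : ℝ, ∫⁻ x, G (x + t • v) = ∫⁻ x, G x := fun t =>
      lintegral_add_right_eq_self G (t • v)
    simp [h3]
  simp_rw [h2]
  simp

theorem enorm_translateAverage_rpow_le (hφ : Continuous φ) (hp : 1 ≤ p) {K : ℝ≥0∞}
    (hK : ν ≤ K • volume) (x : E) :
    ‖translateAverage ν φ x‖ₑ ^ p ≤ K * ∫⁻ x, ‖φ x‖ₑ ^ p := by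
  refine (enorm_integral_rpow_le_lintegral (f := fun v => φ (x + v))
    (hφ.comp (by fun_prop)).aestronglyMeasurable hp).trans ?_
  simp_rw [add_comm x]
  exact lintegral_translate_le hK (fun v => ‖φ v‖ₑ ^ p) x

/-- Averaging with a bounded density turns an L^p bound on the derivative into a pointwise Lipschitz
bound: the ν-integral of a translate of ‖φ'‖^p is at most K times its full integral. -/
theorem enorm_translateAverage_sub_rpow_le (hφ : ContDiff ℝ 1 φ) (hc : HasCompactSupport φ)
    (hp : 1 ≤ p) {K : ℝ≥0∞} (hK : ν ≤ K • volume) (x y : E) :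
    ‖translateAverage ν φ x - translateAverage ν φ y‖ₑ ^ p ≤
      ‖x - y‖ₑ ^ p * (K * ∫⁻ x, ‖fderiv ℝ φ x‖ₑ ^ p) := by
  have hp0 : 0 < p := by linarith
  set G : E → ℝ≥0∞ := fun x => ‖fderiv ℝ φ x‖ₑ ^ p with hG
  have hGm : Measurable G := (hφ.continuous_fderiv one_ne_zero).enorm.measurable.pow_const p
  have h1 : translateAverage ν φ x - translateAverage ν φ y = ∫ v, (φ (x + v) - φ (y + v)) ∂ν :=
    (integral_sub (integrable_translate hφ.continuous hc x)
      (integrable_translate hφ.continuous hc y)).symm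
  rw [h1]
  refine (enorm_integral_rpow_le_lintegral (Continuous.aestronglyMeasurable
    ((hφ.continuous.comp (by fun_prop)).sub (hφ.continuous.comp (by fun_prop)))) hp).trans ?_
  have h2 : ∀ v, ‖φ (x + v) - φ (y + v)‖ₑ ^ p ≤
      ‖x - y‖ₑ ^ p * ∫⁻ t in Set.Ioc (0 : ℝ) 1, G (v + (y + t • (x - y))) := by
    intro v
    have := enorm_sub_rpow_le_lintegral_fderiv hφ hp (y + v) (x - y)
    have e1 : y + v + (x - y) = x + v := by abel
    have e2 : ∀ t : ℝ, y + v + t • (x - y) = v + (y + t • (x - y)) := fun t => by abel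
    simp_rw [e1, e2] at this
    exact this
  refine (lintegral_mono h2).trans ?_
  rw [lintegral_const_mul' _ _ (ENNReal.rpow_ne_top_of_nonneg hp0.le enorm_ne_top)]
  gcongr
  have hm2 : Measurable (Function.uncurry fun (v : E) (t : ℝ) => G (v + (y + t • (x - y)))) :=
    hGm.comp (by fun_prop)
  rw [lintegral_lintegral_swap hm2.aemeasurable]
  refine (lintegral_mono fun t => lintegral_translate_le hK G _).trans ?_
  simp

end Average

section Subsequence

variable {E : Type*} [NormedAddCommGroup E] [InnerProductSpace ℝ E] [FiniteDimensional ℝ E]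
  [MeasurableSpace E] [BorelSpace E]

/-- A uniformly Lipschitz sequence of functions converging on a dense range converges
everywhere. -/
theorem exists_tendsto_of_lipschitz_of_denseRange {X ι : Type*} [PseudoMetricSpace X] {d : ι → X}
    (hd : DenseRange d) {f : ℕ → X → ℝ} {L : ℝ} (hf : ∀ n x y, |f n x - f n y| ≤ L * dist x y)
    (hlim : ∀ i, ∃ l, Tendsto (fun n => f n (d i)) atTop (𝓝 l)) (x : X) :
    ∃ l, Tendsto (fun n => f n x) atTop (𝓝 l) := by
  refine cauchySeq_tendsto_of_complete (Metric.cauchySeq_iff.2 fun ε hε => ?_)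
  obtain ⟨i, hi⟩ := hd.exists_dist_lt x (show 0 < ε / (3 * (|L| + 1)) by positivity)
  obtain ⟨l, hl⟩ := hlim i
  obtain ⟨M, hM⟩ := Metric.cauchySeq_iff.1 hl.cauchySeq (ε / 3) (by positivity)
  have hLx : ∀ n, |f n x - f n (d i)| < ε / 3 := by
    intro n
    refine (hf n x (d i)).trans_lt ?_
    calc L * dist x (d i) ≤ (|L| + 1) * dist x (d i) := by
          gcongr; linarith [le_abs_self L]
      _ < (|L| + 1) * (ε / (3 * (|L| + 1))) := by gcongr
      _ = ε / 3 := by field_simp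
  refine ⟨M, fun m hm n hn => ?_⟩
  have h1 := hM m hm n hn
  rw [Real.dist_eq] at h1 ⊢
  have h2 := hLx m
  have h3 := hLx n
  rw [abs_lt] at *
  constructor <;> linarith

/-- Compactness of the embedding of test functions, bounded in `L^q` with gradients bounded in
`L^p`, into `L^p(μ)` for a finite measure `μ ≤ volume`. -/
theorem exists_subseq_cauchy_eLpNorm {μ : Measure E} [IsFiniteMeasure μ] (hμ : μ ≤ volume)
    {p q : ℝ} (hp : 1 ≤ p) (hq : 1 ≤ q) {φ : ℕ → E → ℝ} (hφ : ∀ n, ContDiff ℝ 1 (φ n))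
    (hc : ∀ n, HasCompactSupport (φ n)) {R : ℝ≥0∞} (hR : R ≠ ⊤)
    (hRp : ∀ n, ∫⁻ x, ‖fderiv ℝ (φ n) x‖ₑ ^ p ≤ R) (hRq : ∀ n, ∫⁻ x, ‖φ n x‖ₑ ^ q ≤ R) :
    ∃ σ : ℕ → ℕ, StrictMono σ ∧ ∀ η : ℝ≥0∞, 0 < η → ∃ M, ∀ n ≥ M, ∀ m ≥ M,
      eLpNorm (fun x => φ (σ n) x - φ (σ m) x) (ENNReal.ofReal p) μ ≤ η := by
  have hp0 : 0 < p := by linarith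
  have hq0 : 0 < q := by linarith
  choose ν K hνp hKt hνK hνε using fun k : ℕ =>
    exists_isProbabilityMeasure_ball (E := E) (ε := 1 / ((k : ℝ) + 1)) (by positivity)
  set f : ℕ → ℕ → E → ℝ := fun k n => translateAverage (ν k) (φ n) with hf
  have root : ∀ {r : ℝ} {a b : ℝ≥0∞}, 0 < r → a ^ r ≤ b → a ≤ b ^ r⁻¹ := by
    intro r a b hr h
    rwa [ENNReal.le_rpow_inv_iff hr]
  have hKR : ∀ k, K k * R ≠ ⊤ := fun k => ENNReal.mul_ne_top (hKt k) hR
  set b : ℕ → ℝ≥0∞ := fun k => (K k * R) ^ q⁻¹ with hb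
  have hbt : ∀ k, b k ≠ ⊤ := fun k => ENNReal.rpow_ne_top_of_nonneg (by positivity) (hKR k)
  have hbound : ∀ k n x, ‖f k n x‖ₑ ≤ b k := by
    intro k n x
    refine root hq0 ((enorm_translateAverage_rpow_le (hφ n).continuous hq (hνK k) x).trans ?_)
    gcongr
    exact hRq n
  set L : ℕ → ℝ≥0∞ := fun k => (K k * R) ^ p⁻¹ with hL
  have hLt : ∀ k, L k ≠ ⊤ := fun k => ENNReal.rpow_ne_top_of_nonneg (by positivity) (hKR k)
  have hlip : ∀ k n x y, |f k n x - f k n y| ≤ (L k).toReal * dist x y := by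
    intro k n x y
    have h1 := root hp0 ((enorm_translateAverage_sub_rpow_le (hφ n) (hc n) hp (hνK k) x y).trans
      (mul_le_mul_right (mul_le_mul_right (hRp n) _) _))
    rw [ENNReal.mul_rpow_of_nonneg _ _ (by positivity), ← ENNReal.rpow_mul,
      mul_inv_cancel₀ hp0.ne', ENNReal.rpow_one] at h1
    have h2 := ENNReal.toReal_mono (ENNReal.mul_ne_top enorm_ne_top (hLt k)) h1
    rw [ENNReal.toReal_mul, toReal_enorm, toReal_enorm, mul_comm,
      Real.norm_eq_abs, ← dist_eq_norm x y] at h2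
    exact h2
  have hcontf : ∀ k n, Continuous (f k n) := fun k n =>
    (LipschitzWith.of_dist_le_mul (K := (L k).toNNReal) fun x y => hlip k n x y).continuous
  -- Compactness of a countable product replaces the diagonal argument: one subsequence converges
  -- for every radius index and every point of a dense sequence, and the Lipschitz bounds extend
  -- this to all points.
  have hcpt : IsCompact (Set.pi Set.univ fun j : ℕ × ℕ =>
      Set.Icc (-(b j.1).toReal) (b j.1).toReal) := isCompact_univ_pi fun j => isCompact_Icc
  obtain ⟨T, -, σ, hσ, hT⟩ := hcpt.tendsto_subseq
    (x := fun n (j : ℕ × ℕ) => f j.1 n (TopologicalSpace.denseSeq E j.2)) (by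
      intro n j _
      have h1 := ENNReal.toReal_mono (hbt j.1) (hbound j.1 n (TopologicalSpace.denseSeq E j.2))
      rw [toReal_enorm, Real.norm_eq_abs] at h1
      exact abs_le.1 h1)
  refine ⟨σ, hσ, fun η hη => ?_⟩
  have hv : ∀ k x, ∃ l, Tendsto (fun n => f k (σ n) x) atTop (𝓝 l) := fun k =>
    exists_tendsto_of_lipschitz_of_denseRange (TopologicalSpace.denseRange_denseSeq E)
      (fun n => hlip k (σ n)) fun i => ⟨T (k, i), (tendsto_pi_nhds.1 hT) (k, i)⟩
  choose v hv using hv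
  have hvm : ∀ k, Measurable (v k) := fun k =>
    measurable_of_tendsto_metrizable (fun n => (hcontf k (σ n)).measurable)
      (tendsto_pi_nhds.2 (hv k))
  have hvb : ∀ k x, ‖v k x‖ₑ ≤ b k := fun k x =>
    le_of_tendsto ((continuous_enorm.tendsto _).comp (hv k x))
      (Eventually.of_forall fun n => hbound k _ x)
  have hpne : ENNReal.ofReal p ≠ 0 := by simpa using hp0
  have hLp : ∀ (g : E → ℝ) (τ : Measure E), eLpNorm g (ENNReal.ofReal p) τ =
      (∫⁻ x, ‖g x‖ₑ ^ p ∂τ) ^ p⁻¹ := by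
    intro g τ
    rw [eLpNorm_eq_lintegral_rpow_enorm_toReal hpne ENNReal.ofReal_ne_top,
      ENNReal.toReal_ofReal hp0.le, one_div]
  have hconv : ∀ k, Tendsto (fun n => eLpNorm (fun x => f k (σ n) x - v k x)
      (ENNReal.ofReal p) μ) atTop (𝓝 0) := by
    intro k
    simp_rw [hLp]
    have h0 : (0 : ℝ≥0∞) = (∫⁻ _ : E, 0 ∂μ) ^ p⁻¹ := by
      rw [lintegral_zero, ENNReal.zero_rpow_of_pos (by positivity)]
    rw [h0]
    refine (ENNReal.continuous_rpow_const.tendsto _).comp ?_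
    -- A constant majorant is integrable because μ is finite; this is why no localization to bounded
    -- sets is needed.
    refine tendsto_lintegral_of_dominated_convergence (fun _ => (b k + b k) ^ p) ?_ ?_ ?_ ?_
    · intro n
      exact ((hcontf k (σ n)).measurable.sub (hvm k)).enorm.pow_const p
    · intro n
      refine Eventually.of_forall fun x => ENNReal.rpow_le_rpow ?_ hp0.le
      exact (enorm_sub_le).trans (add_le_add (hbound k _ x) (hvb k x))
    · rw [lintegral_const]
      exact ENNReal.mul_ne_top (ENNReal.rpow_ne_top_of_nonneg hp0.le
        (ENNReal.add_ne_top.2 ⟨hbt k, hbt k⟩)) (measure_ne_top _ _)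
    · refine Eventually.of_forall fun x => ?_
      have h1 : Tendsto (fun n => f k (σ n) x - v k x) atTop (𝓝 0) := by
        simpa using (hv k x).sub_const (v k x)
      have h2 := (ENNReal.continuous_rpow_const (y := p)).tendsto ‖(0 : ℝ)‖ₑ |>.comp
        ((continuous_enorm.tendsto (0 : ℝ)).comp h1)
      simpa [Function.comp_def, ENNReal.zero_rpow_of_pos hp0] using h2
  have herr : ∀ k n, eLpNorm (fun x => f k n x - φ n x) (ENNReal.ofReal p) μ ≤
      ENNReal.ofReal (1 / ((k : ℝ) + 1)) * R ^ p⁻¹ := by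
    intro k n
    refine (eLpNorm_mono_measure _ hμ).trans ?_
    rw [hLp]
    refine (ENNReal.rpow_le_rpow (z := p⁻¹) ((lintegral_enorm_translateAverage_sub_rpow_le (hφ n)
      (hc n) hp (hνε k)).trans (mul_le_mul_right (hRp n) _)) (by positivity)).trans ?_
    rw [ENNReal.mul_rpow_of_nonneg _ _ (by positivity), ← ENNReal.rpow_mul,
      mul_inv_cancel₀ hp0.ne', ENNReal.rpow_one]
  have hη4 : 0 < η / 4 := ENNReal.div_pos hη.ne' (by norm_num)
  obtain ⟨k, hk⟩ : ∃ k : ℕ, ENNReal.ofReal (1 / ((k : ℝ) + 1)) * R ^ p⁻¹ < η / 4 := by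
    have h1 : Tendsto (fun k : ℕ => ENNReal.ofReal (1 / ((k : ℝ) + 1)) * R ^ p⁻¹) atTop
        (𝓝 (ENNReal.ofReal 0 * R ^ p⁻¹)) :=
      ENNReal.Tendsto.mul_const (ENNReal.tendsto_ofReal tendsto_one_div_add_atTop_nhds_zero_nat)
        (Or.inr (ENNReal.rpow_ne_top_of_nonneg (by positivity) hR))
    rw [ENNReal.ofReal_zero, zero_mul] at h1
    exact (h1.eventually (gt_mem_nhds hη4)).exists
  obtain ⟨M, hM⟩ := eventually_atTop.1 ((hconv k).eventually (gt_mem_nhds hη4))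
  refine ⟨M, fun n hn m hm => ?_⟩
  have hq1 : 1 ≤ ENNReal.ofReal p := by simpa using hp
  have ms : ∀ n, AEStronglyMeasurable (fun x => f k n x - φ n x) μ := fun n =>
    ((hcontf k n).sub (hφ n).continuous).aestronglyMeasurable
  have mv : ∀ n, AEStronglyMeasurable (fun x => f k n x - v k x) μ := fun n =>
    ((hcontf k n).measurable.sub (hvm k)).aestronglyMeasurable
  -- Four errors of size η / 4: two from averaging, uniform in the index once k is fixed, and two
  -- from convergence of the averages to `v k`.
  have hdec : (fun x => φ (σ n) x - φ (σ m) x) =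
      ((fun x => f k (σ n) x - v k x) - fun x => f k (σ m) x - v k x) +
      ((fun x => f k (σ m) x - φ (σ m) x) - fun x => f k (σ n) x - φ (σ n) x) := by
    ext x
    simp only [Pi.add_apply, Pi.sub_apply]
    ring
  rw [hdec]
  refine (eLpNorm_add_le ((mv _).sub (mv _)) ((ms _).sub (ms _)) hq1).trans ?_
  refine (add_le_add (eLpNorm_sub_le (mv _) (mv _) hq1) (eLpNorm_sub_le (ms _) (ms _) hq1)).trans ?_
  have h4 : η / 4 + η / 4 + (η / 4 + η / 4) = η := by
    have h2 : η / 4 + η / 4 = η / 2 := by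
      rw [ENNReal.div_add_div_same, ← two_mul, show (4 : ℝ≥0∞) = 2 * 2 by norm_num,
        ENNReal.mul_div_mul_left _ _ (by norm_num) (by norm_num)]
    rw [h2, ENNReal.add_halves]
  rw [← h4]
  exact add_le_add (add_le_add (hM n hn).le (hM m hm).le)
    (add_le_add ((herr k _).trans hk.le) ((herr k _).trans hk.le))

end Subsequence

end Compactness

/-! ### The Beppo-Levi space: completeness, linear structure, Sobolev inequality, embedding. -/

noncomputable section BeppoLevi

theorem exists_tendsto_eLpNorm_of_cauchy {X F : Type*} [MeasurableSpace X] {μ : Measure X}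
    [NormedAddCommGroup F] [CompleteSpace F] {q : ℝ≥0∞} (hq : 1 ≤ q) {f : ℕ → X → F}
    (hf : ∀ n, MemLp (f n) q μ)
    (hcau : Tendsto (fun n : ℕ × ℕ => eLpNorm (fun x => f n.1 x - f n.2 x) q μ) atTop (𝓝 0)) :
    ∃ g, MemLp g q μ ∧ Tendsto (fun n => eLpNorm (fun x => f n x - g x) q μ) atTop (𝓝 0) := by
  have : Fact (1 ≤ q) := ⟨hq⟩
  have hc : CauchySeq fun n => (hf n).toLp (f n) := by
    rw [EMetric.cauchySeq_iff]
    intro ε hε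
    obtain ⟨M, hM⟩ := eventually_atTop.1 (hcau.eventually (gt_mem_nhds hε))
    refine ⟨max M.1 M.2, fun m hm n hn => ?_⟩
    rw [Lp.edist_toLp_toLp]
    exact hM (m, n) ⟨(le_max_left _ _).trans hm, (le_max_right _ _).trans hn⟩
  obtain ⟨g, hg⟩ := cauchySeq_tendsto_of_complete hc
  refine ⟨g, Lp.memLp g, ?_⟩
  have h1 : (Lp.memLp g).toLp g = g := Lp.toLp_coeFn g (Lp.memLp g)
  rw [← h1, Lp.tendsto_Lp_iff_tendsto_eLpNorm''] at hg
  exact hg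

theorem tendsto_eLpNorm_zero_of_integral {X F : Type*} [MeasurableSpace X] {μ : Measure X}
    [NormedAddCommGroup F] {p : ℝ} (hp : 0 < p) {ι : Type*} {l : Filter ι} {f : ι → X → F}
    (hf : ∀ n, MemLp (f n) (ENNReal.ofReal p) μ)
    (h : Tendsto (fun n => ∫ x, ‖f n x‖ ^ p ∂μ) l (𝓝 0)) :
    Tendsto (fun n => eLpNorm (f n) (ENNReal.ofReal p) μ) l (𝓝 0) := by
  have h1 : ∀ n, eLpNorm (f n) (ENNReal.ofReal p) μ =
      ENNReal.ofReal (∫ x, ‖f n x‖ ^ p ∂μ) ^ p⁻¹ := by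
    intro n
    rw [← eLpNorm_ofReal_rpow_eq hp (hf n), ← ENNReal.rpow_mul, mul_inv_cancel₀ hp.ne',
      ENNReal.rpow_one]
  simp_rw [h1]
  have h2 := (ENNReal.continuous_rpow_const (y := p⁻¹)).tendsto _ |>.comp
    (ENNReal.tendsto_ofReal h)
  simpa [Function.comp_def, ENNReal.zero_rpow_of_pos (inv_pos.2 hp)] using h2

theorem tendsto_integral_zero_of_eLpNorm {X F : Type*} [MeasurableSpace X] {μ : Measure X}
    [NormedAddCommGroup F] {p : ℝ} (hp : 0 < p) {ι : Type*} {l : Filter ι} {f : ι → X → F}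
    (hf : ∀ n, MemLp (f n) (ENNReal.ofReal p) μ)
    (h : Tendsto (fun n => eLpNorm (f n) (ENNReal.ofReal p) μ) l (𝓝 0)) :
    Tendsto (fun n => ∫ x, ‖f n x‖ ^ p ∂μ) l (𝓝 0) := by
  simp_rw [fun n => integral_norm_rpow_eq hp (hf n)]
  have h1 := ((ENNReal.tendsto_toReal ENNReal.zero_ne_top).comp h).rpow_const
    (p := p) (Or.inr hp.le)
  simpa [Function.comp_def, Real.zero_rpow hp.ne'] using h1

variable {N : ℕ}

/-- Test functions `φ ∈ C_c^∞(ℝ^N)`. -/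
def IsTestFun (φ : EuclideanSpace ℝ (Fin N) → ℝ) : Prop := ContDiff ℝ ∞ φ ∧ HasCompactSupport φ

theorem norm_gradient_eq (φ : EuclideanSpace ℝ (Fin N) → ℝ) (x : EuclideanSpace ℝ (Fin N)) :
    ‖gradient φ x‖ = ‖fderiv ℝ φ x‖ :=
  LinearIsometryEquiv.norm_map _ _

theorem gradient_add_smul {φ ψ : EuclideanSpace ℝ (Fin N) → ℝ} (hφ : Differentiable ℝ φ)
    (hψ : Differentiable ℝ ψ) (c d : ℝ) (x : EuclideanSpace ℝ (Fin N)) :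
    gradient (fun x => c * φ x + d * ψ x) x = c • gradient φ x + d • gradient ψ x := by
  unfold gradient
  rw [fderiv_fun_add ((hφ x).const_mul c) ((hψ x).const_mul d), fderiv_const_mul (hφ x),
    fderiv_const_mul (hψ x)]
  simp

namespace IsTestFun

variable {φ ψ : EuclideanSpace ℝ (Fin N) → ℝ}

theorem contDiff_one (h : IsTestFun φ) : ContDiff ℝ 1 φ := h.1.of_le (by simp)

theorem differentiable (h : IsTestFun φ) : Differentiable ℝ φ :=
  h.contDiff_one.differentiable one_ne_zero

theorem add_smul (h : IsTestFun φ) (h' : IsTestFun ψ) (c d : ℝ) :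
    IsTestFun fun x => c * φ x + d * ψ x :=
  ⟨(contDiff_const.mul h.1).add (contDiff_const.mul h'.1), (h.2.mul_left).add (h'.2.mul_left)⟩

theorem continuous_gradient (h : IsTestFun φ) : Continuous (gradient φ) :=
  (LinearIsometryEquiv.continuous _).comp (h.contDiff_one.continuous_fderiv one_ne_zero)

theorem hasCompactSupport_gradient (h : IsTestFun φ) : HasCompactSupport (gradient φ) :=
  (h.2.fderiv ℝ).comp_left (map_zero _)

theorem memLp (h : IsTestFun φ) (q : ℝ≥0∞) (μ : Measure (EuclideanSpace ℝ (Fin N)))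
    [IsFiniteMeasureOnCompacts μ] : MemLp φ q μ :=
  h.1.continuous.memLp_of_hasCompactSupport h.2

theorem memLp_gradient (h : IsTestFun φ) (q : ℝ≥0∞) : MemLp (gradient φ) q volume :=
  h.continuous_gradient.memLp_of_hasCompactSupport h.hasCompactSupport_gradient

theorem gradient_sub (h : IsTestFun φ) (h' : IsTestFun ψ) (x : EuclideanSpace ℝ (Fin N)) :
    gradient (fun x => φ x - ψ x) x = gradient φ x - gradient ψ x := by
  have := gradient_add_smul h.differentiable h'.differentiable 1 (-1) x
  simpa [← sub_eq_add_neg] using this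

theorem sub (h : IsTestFun φ) (h' : IsTestFun ψ) : IsTestFun fun x => φ x - ψ x :=
  ⟨h.1.sub h'.1, h.2.sub h'.2⟩

end IsTestFun

theorem lt_criticalExponent {p : ℝ} (hp : 0 < p) (hpN : p < N) : p < criticalExponent N p := by
  unfold criticalExponent
  rw [lt_div_iff₀ (by linarith)]
  nlinarith

theorem exists_sobolev_const {p : ℝ} (hp : 1 < p) (hpN : p < N) :
    ∃ S : ℝ, 0 ≤ S ∧ ∀ φ : EuclideanSpace ℝ (Fin N) → ℝ, IsTestFun φ →
      eLpNorm φ (ENNReal.ofReal (criticalExponent N p)) volume ≤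
        ENNReal.ofReal S * eLpNorm (gradient φ) (ENNReal.ofReal p) volume := by
  have hp0 : 0 < p := by linarith
  have hN : (0 : ℝ) < N := by linarith
  have hps : 0 < criticalExponent N p := hp0.trans (lt_criticalExponent hp0 hpN)
  refine ⟨SNormLESNormFDerivOfEqConst (E := EuclideanSpace ℝ (Fin N)) ℝ volume p.toNNReal,
    NNReal.coe_nonneg _, fun φ hφ => ?_⟩
  have h := eLpNorm_le_eLpNorm_fderiv_of_eq (E := EuclideanSpace ℝ (Fin N)) (F := ℝ) volume
    hφ.contDiff_one hφ.2 (p := p.toNNReal) (p' := (criticalExponent N p).toNNReal)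
    (by simpa using hp.le) (by simpa using hN) (by
      rw [NNReal.coe_inv, Real.coe_toNNReal _ hps.le, Real.coe_toNNReal _ hp0.le,
        finrank_euclideanSpace_fin]
      have : (N : ℝ) - p ≠ 0 := by linarith
      unfold criticalExponent
      field_simp)
  rw [ENNReal.ofReal_coe_nnreal]
  have h2 : eLpNorm (gradient φ) (ENNReal.ofReal p) volume =
      eLpNorm (fderiv ℝ φ) (ENNReal.ofReal p) volume :=
    eLpNorm_congr_norm_ae (Eventually.of_forall fun x => norm_gradient_eq φ x)
  rw [h2]
  exact h

theorem IsTestFun.hasD1pGradient {p : ℝ} {φ : EuclideanSpace ℝ (Fin N) → ℝ} (h : IsTestFun φ) :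
    HasD1pGradient p φ (gradient φ) :=
  ⟨h.memLp _ _, h.memLp_gradient _, fun _ => φ, fun _ => h, by simp, by simp⟩

/-- Sobolev's inequality applied to differences makes the functions Cauchy in L^{p*} once their
gradients are Cauchy in L^p; the two limits form an element of the space. -/
theorem exists_hasD1pGradient_of_cauchy {p : ℝ} (hp : 1 < p) (hpN : p < N)
    {φ : ℕ → EuclideanSpace ℝ (Fin N) → ℝ} (hφ : ∀ n, IsTestFun (φ n))
    (hcau : Tendsto (fun n : ℕ × ℕ => eLpNorm
      (fun x => gradient (φ n.1) x - gradient (φ n.2) x) (ENNReal.ofReal p) volume) atTop (𝓝 0)) :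
    ∃ u V, HasD1pGradient p u V ∧
      Tendsto (fun n => eLpNorm (fun x => φ n x - u x)
        (ENNReal.ofReal (criticalExponent N p)) volume) atTop (𝓝 0) ∧
      Tendsto (fun n => eLpNorm (fun x => gradient (φ n) x - V x)
        (ENNReal.ofReal p) volume) atTop (𝓝 0) := by
  have hps := lt_criticalExponent (by linarith) hpN
  obtain ⟨V, hV, hVt⟩ := exists_tendsto_eLpNorm_of_cauchy (by simpa using hp.le)
    (fun n => (hφ n).memLp_gradient _) hcau
  obtain ⟨S, hS, hSob⟩ := exists_sobolev_const hp hpN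
  obtain ⟨u, hu, hut⟩ := exists_tendsto_eLpNorm_of_cauchy
    (q := ENNReal.ofReal (criticalExponent N p)) (μ := volume)
    (by simpa using (hp.trans hps).le) (fun n => (hφ n).memLp _ _) (by
      have h1 : Tendsto (fun n : ℕ × ℕ => ENNReal.ofReal S * eLpNorm
          (fun x => gradient (φ n.1) x - gradient (φ n.2) x) (ENNReal.ofReal p) volume) atTop
          (𝓝 0) := by
        simpa using ENNReal.Tendsto.const_mul hcau (Or.inr ENNReal.ofReal_ne_top)
      refine tendsto_of_tendsto_of_tendsto_of_le_of_le tendsto_const_nhds h1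
        (fun _ => zero_le) fun n => ?_
      refine (hSob _ ((hφ n.1).sub (hφ n.2))).trans_eq ?_
      simp_rw [funext ((hφ n.1).gradient_sub (hφ n.2))])
  exact ⟨u, V, ⟨hu, hV, φ, hφ, hut, hVt⟩, hut, hVt⟩

namespace HasD1pGradient

variable {p : ℝ} {u v : EuclideanSpace ℝ (Fin N) → ℝ}
  {U V : EuclideanSpace ℝ (Fin N) → EuclideanSpace ℝ (Fin N)}

/-- Makes the variations u + tφ admissible competitors in the minimization. -/
theorem add_smul (hp : 1 < p) (hpN : p < N) (hu : HasD1pGradient p u U)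
    (hv : HasD1pGradient p v V) (t : ℝ) :
    HasD1pGradient p (fun x => u x + t * v x) (fun x => U x + t • V x) := by
  have hps := lt_criticalExponent (by linarith) hpN
  obtain ⟨φ, hφ, hφu, hφU⟩ := hu.approx
  obtain ⟨ψ, hψ, hψv, hψV⟩ := hv.approx
  have key : ∀ {F : Type} [NormedAddCommGroup F] [NormedSpace ℝ F] {q : ℝ≥0∞} (_ : 1 ≤ q)
      {f g : ℕ → EuclideanSpace ℝ (Fin N) → F} {f₀ g₀ : EuclideanSpace ℝ (Fin N) → F}
      (_ : ∀ n, MemLp (f n) q volume) (_ : ∀ n, MemLp (g n) q volume)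
      (_ : MemLp f₀ q volume) (_ : MemLp g₀ q volume)
      (_ : Tendsto (fun n => eLpNorm (fun x => f n x - f₀ x) q volume) atTop (𝓝 0))
      (_ : Tendsto (fun n => eLpNorm (fun x => g n x - g₀ x) q volume) atTop (𝓝 0)),
      Tendsto (fun n => eLpNorm (fun x => (f n x + t • g n x) - (f₀ x + t • g₀ x)) q volume)
        atTop (𝓝 0) := by
    intro F _ _ q hq f g f₀ g₀ hf hg hf₀ hg₀ h1 h2
    have h3 : Tendsto (fun n => eLpNorm (fun x => f n x - f₀ x) q volume +
        ‖t‖ₑ * eLpNorm (fun x => g n x - g₀ x) q volume) atTop (𝓝 0) := by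
      simpa using h1.add (ENNReal.Tendsto.const_mul h2 (Or.inr enorm_ne_top))
    refine tendsto_of_tendsto_of_tendsto_of_le_of_le tendsto_const_nhds h3
      (fun _ => zero_le) fun n => ?_
    have h4 : (fun x => (f n x + t • g n x) - (f₀ x + t • g₀ x)) =
        (fun x => f n x - f₀ x) + t • fun x => g n x - g₀ x := by
      ext1 x
      simp only [Pi.add_apply, Pi.smul_apply, smul_sub]
      abel
    simp only
    rw [h4, ← eLpNorm_const_smul]
    exact eLpNorm_add_le ((hf n).sub hf₀).1 (((hg n).sub hg₀).1.const_smul t) hq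
  refine ⟨hu.memLp.add (hv.memLp.const_mul t), hu.memLp_grad.add (hv.memLp_grad.const_smul t),
    fun n x => 1 * φ n x + t * ψ n x, fun n => IsTestFun.add_smul (hφ n) (hψ n) 1 t, ?_, ?_⟩
  · simpa using key (by simpa using (hp.trans hps).le) (fun n => IsTestFun.memLp (hφ n) _ _)
      (fun n => IsTestFun.memLp (hψ n) _ _) hu.memLp hv.memLp hφu hψv
  · have hg : ∀ n x, gradient (fun x => 1 * φ n x + t * ψ n x) x =
        gradient (φ n) x + t • gradient (ψ n) x := fun n x => by
      rw [gradient_add_smul (IsTestFun.differentiable (hφ n)) (IsTestFun.differentiable (hψ n)),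
        one_smul]
    simp_rw [hg]
    exact key (by simpa using hp.le) (fun n => IsTestFun.memLp_gradient (hφ n) _)
      (fun n => IsTestFun.memLp_gradient (hψ n) _) hu.memLp_grad hv.memLp_grad hφU hψV

end HasD1pGradient

section Embedding

variable {μ : Measure (EuclideanSpace ℝ (Fin N))} {p : ℝ}

/-- Hölder's inequality with respect to μ, then μ ≤ volume. -/
theorem eLpNorm_le_mul_eLpNorm_criticalExponent (hμ : μ ≤ volume) (hp : 1 < p) (hpN : p < N)
    {u : EuclideanSpace ℝ (Fin N) → ℝ} (hu : AEStronglyMeasurable u volume) :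
    eLpNorm u (ENNReal.ofReal p) μ ≤ μ Set.univ ^ (1 / p - 1 / criticalExponent N p) *
      eLpNorm u (ENNReal.ofReal (criticalExponent N p)) volume := by
  have hps := lt_criticalExponent (by linarith) hpN
  have hac : μ ≪ volume := Measure.absolutelyContinuous_of_le hμ
  refine (eLpNorm_le_eLpNorm_mul_rpow_measure_univ (ENNReal.ofReal_le_ofReal hps.le)
    (hu.mono_ac hac)).trans ?_
  rw [mul_comm, ENNReal.toReal_ofReal (by linarith), ENNReal.toReal_ofReal (by linarith)]
  gcongr

variable [IsFiniteMeasure μ]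

theorem measure_univ_rpow_ne_top (hp : 1 < p) (hpN : p < N) :
    μ Set.univ ^ (1 / p - 1 / criticalExponent N p) ≠ ⊤ := by
  have hps := lt_criticalExponent (by linarith) hpN
  refine ENNReal.rpow_ne_top_of_nonneg ?_ (measure_ne_top _ _)
  exact sub_nonneg.2 (one_div_le_one_div_of_le (by linarith) hps.le)

theorem HasD1pGradient.memLp_measure (hμ : μ ≤ volume) (hp : 1 < p) (hpN : p < N)
    {u : EuclideanSpace ℝ (Fin N) → ℝ} {V : EuclideanSpace ℝ (Fin N) → EuclideanSpace ℝ (Fin N)}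
    (h : HasD1pGradient p u V) : MemLp u (ENNReal.ofReal p) μ :=
  ⟨h.memLp.1.mono_ac (Measure.absolutelyContinuous_of_le hμ),
    (eLpNorm_le_mul_eLpNorm_criticalExponent hμ hp hpN h.memLp.1).trans_lt
      (ENNReal.mul_lt_top (measure_univ_rpow_ne_top hp hpN).lt_top h.memLp.2)⟩

theorem tendsto_eLpNorm_measure (hμ : μ ≤ volume) (hp : 1 < p) (hpN : p < N)
    {φ : ℕ → EuclideanSpace ℝ (Fin N) → ℝ} (hφ : ∀ n, IsTestFun (φ n))
    {u : EuclideanSpace ℝ (Fin N) → ℝ} (hu : AEStronglyMeasurable u volume)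
    (h : Tendsto (fun n => eLpNorm (fun x => φ n x - u x)
        (ENNReal.ofReal (criticalExponent N p)) volume) atTop (𝓝 0)) :
    Tendsto (fun n => eLpNorm (fun x => φ n x - u x) (ENNReal.ofReal p) μ) atTop (𝓝 0) := by
  have h1 := ENNReal.Tendsto.const_mul h
    (Or.inr (measure_univ_rpow_ne_top (μ := μ) hp hpN))
  rw [mul_zero] at h1
  exact tendsto_of_tendsto_of_tendsto_of_le_of_le tendsto_const_nhds h1 (fun _ => zero_le)
    fun n => eLpNorm_le_mul_eLpNorm_criticalExponent hμ hp hpN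
      ((hφ n).1.continuous.aestronglyMeasurable.sub hu)

/-- Sobolev's inequality passes from test functions to their limits and is combined with Hölder. In
particular the infimum defining `weightedEmbeddingNorm` is over a nonempty set when α > 0. -/
theorem exists_embedding_const (hμ : μ ≤ volume) (hp : 1 < p) (hpN : p < N) :
    ∃ C : ℝ, 0 ≤ C ∧ ∀ (u : EuclideanSpace ℝ (Fin N) → ℝ)
      (V : EuclideanSpace ℝ (Fin N) → EuclideanSpace ℝ (Fin N)), HasD1pGradient p u V →
      eLpNorm u (ENNReal.ofReal p) μ ≤
        ENNReal.ofReal C * eLpNorm V (ENNReal.ofReal p) volume := by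
  have hps := lt_criticalExponent (by linarith) hpN
  obtain ⟨S, hS, hSob⟩ := exists_sobolev_const hp hpN
  set c := μ Set.univ ^ (1 / p - 1 / criticalExponent N p) with hc
  have hct : c ≠ ⊤ := measure_univ_rpow_ne_top hp hpN
  refine ⟨c.toReal * S, by positivity, fun u V h => ?_⟩
  have h1 : eLpNorm u (ENNReal.ofReal (criticalExponent N p)) volume ≤
      ENNReal.ofReal S * eLpNorm V (ENNReal.ofReal p) volume := by
    obtain ⟨φ, hφ, hφu, hφV⟩ := h.approx
    have t1 := tendsto_eLpNorm_of_tendsto_sub (by simpa using (hp.trans hps).le)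
      (fun n => (hφ n).1.continuous.aestronglyMeasurable) h.memLp hφu
    have t2 := tendsto_eLpNorm_of_tendsto_sub (by simpa using hp.le)
      (fun n => (IsTestFun.continuous_gradient (hφ n)).aestronglyMeasurable) h.memLp_grad hφV
    exact le_of_tendsto_of_tendsto' t1
      (ENNReal.Tendsto.const_mul t2 (Or.inr ENNReal.ofReal_ne_top)) fun n => hSob _ (hφ n)
  refine (eLpNorm_le_mul_eLpNorm_criticalExponent hμ hp hpN h.memLp.1).trans ?_
  rw [ENNReal.ofReal_mul ENNReal.toReal_nonneg, ENNReal.ofReal_toReal hct, mul_assoc]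
  gcongr

end Embedding

end BeppoLevi

/-! ### Coercivity of the energy and existence of a minimizer. -/

noncomputable section Minimization

section Lp

variable {X F : Type*} [MeasurableSpace X] {μ : Measure X} {p : ℝ}

theorem lintegral_enorm_rpow_eq [NormedAddCommGroup F] (hp : 0 < p) (f : X → F) :
    ∫⁻ x, ‖f x‖ₑ ^ p ∂μ = eLpNorm f (ENNReal.ofReal p) μ ^ p := by
  rw [eLpNorm_eq_lintegral_rpow_enorm_toReal (by simpa using hp) ENNReal.ofReal_ne_top,
    ENNReal.toReal_ofReal hp.le, ← ENNReal.rpow_mul, one_div, inv_mul_cancel₀ hp.ne',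
    ENNReal.rpow_one]

variable [NormedAddCommGroup F] [InnerProductSpace ℝ F] {f g : X → F}

theorem memLp_midpoint {q : ℝ≥0∞} (hf : MemLp f q μ) (hg : MemLp g q μ) :
    MemLp (fun x => (1 / 2 : ℝ) • (f x + g x)) q μ :=
  (hf.add hg).const_smul (1 / 2 : ℝ)

theorem integral_midpoint_le (hp : 1 < p) (hf : MemLp f (ENNReal.ofReal p) μ)
    (hg : MemLp g (ENNReal.ofReal p) μ) :
    ∫ x, ‖(1 / 2 : ℝ) • (f x + g x)‖ ^ p ∂μ ≤ (∫ x, ‖f x‖ ^ p ∂μ + ∫ x, ‖g x‖ ^ p ∂μ) / 2 := by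
  have hp0 : 0 < p := by linarith
  have if' := hf.integrable_norm_rpow_ofReal hp0
  have ig := hg.integrable_norm_rpow_ofReal hp0
  have im := (memLp_midpoint hf hg).integrable_norm_rpow_ofReal hp0
  rw [← integral_add if' ig, ← integral_div]
  exact integral_mono im ((if'.add ig).div_const 2) fun x => norm_rpow_midpoint_le hp (f x) (g x)

theorem integral_sub_le_midpoint_defect (hp : 1 < p) (hf : MemLp f (ENNReal.ofReal p) μ)
    (hg : MemLp g (ENNReal.ofReal p) μ) {ε K : ℝ}
    (hK : ∀ a b : F, ‖a - b‖ ^ p ≤ ε * (‖a‖ ^ p + ‖b‖ ^ p) +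
      K * ((‖a‖ ^ p + ‖b‖ ^ p) / 2 - ‖(1 / 2 : ℝ) • (a + b)‖ ^ p)) :
    ∫ x, ‖f x - g x‖ ^ p ∂μ ≤ ε * (∫ x, ‖f x‖ ^ p ∂μ + ∫ x, ‖g x‖ ^ p ∂μ) +
      K * ((∫ x, ‖f x‖ ^ p ∂μ + ∫ x, ‖g x‖ ^ p ∂μ) / 2 -
        ∫ x, ‖(1 / 2 : ℝ) • (f x + g x)‖ ^ p ∂μ) := by
  have hp0 : 0 < p := by linarith
  have if' := hf.integrable_norm_rpow_ofReal hp0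
  have ig := hg.integrable_norm_rpow_ofReal hp0
  have im := (memLp_midpoint hf hg).integrable_norm_rpow_ofReal hp0
  have is := (hf.sub hg).integrable_norm_rpow_ofReal hp0
  have ia : Integrable (fun x => ‖f x‖ ^ p + ‖g x‖ ^ p) μ := if'.add ig
  have id' : Integrable (fun x => (‖f x‖ ^ p + ‖g x‖ ^ p) / 2 -
    ‖(1 / 2 : ℝ) • (f x + g x)‖ ^ p) μ := (ia.div_const 2).sub im
  refine (integral_mono is ((ia.const_mul ε).add (id'.const_mul K))
    fun x => hK (f x) (g x)).trans_eq ?_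
  rw [integral_add' (ia.const_mul ε) (id'.const_mul K), integral_const_mul, integral_const_mul,
    integral_sub (ia.div_const 2) im, integral_div, integral_add if' ig]

end Lp

variable {N : ℕ} {μ : Measure (EuclideanSpace ℝ (Fin N))} {p : ℝ}
  {h : EuclideanSpace ℝ (Fin N) → ℝ → ℝ} {A B C : ℝ}

/-- `C` bounds the norm of the embedding of `D^{1,p}(ℝ^N)` into `L^p(μ)`. -/
def IsEmbeddingBound (μ : Measure (EuclideanSpace ℝ (Fin N))) (p C : ℝ) : Prop :=
  0 ≤ C ∧ ∀ (u : EuclideanSpace ℝ (Fin N) → ℝ)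
    (V : EuclideanSpace ℝ (Fin N) → EuclideanSpace ℝ (Fin N)), HasD1pGradient p u V →
      eLpNorm u (ENNReal.ofReal p) μ ≤ ENNReal.ofReal C * eLpNorm V (ENNReal.ofReal p) volume

/-- The energy functional of `-Δ_p u = h(x, u) μ`. -/
def energy (μ : Measure (EuclideanSpace ℝ (Fin N))) (p : ℝ)
    (h : EuclideanSpace ℝ (Fin N) → ℝ → ℝ) (u : EuclideanSpace ℝ (Fin N) → ℝ)
    (V : EuclideanSpace ℝ (Fin N) → EuclideanSpace ℝ (Fin N)) : ℝ :=
  (∫ x, ‖V x‖ ^ p) / p - ∫ x, primitive h x (u x) ∂μ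

variable [IsFiniteMeasure μ]

theorem IsEmbeddingBound.integral_le (hC : IsEmbeddingBound μ p C) (hμ : μ ≤ volume) (hp : 1 < p)
    (hpN : p < N) {u : EuclideanSpace ℝ (Fin N) → ℝ}
    {V : EuclideanSpace ℝ (Fin N) → EuclideanSpace ℝ (Fin N)} (hu : HasD1pGradient p u V) :
    ∫ x, ‖u x‖ ^ p ∂μ ≤ C ^ p * ∫ x, ‖V x‖ ^ p := by
  have hp0 : 0 < p := by linarith
  rw [integral_norm_rpow_eq hp0 (hu.memLp_measure hμ hp hpN),
    integral_norm_rpow_eq hp0 hu.memLp_grad, ← Real.mul_rpow hC.1 ENNReal.toReal_nonneg]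
  refine Real.rpow_le_rpow ENNReal.toReal_nonneg ?_ hp0.le
  have := ENNReal.toReal_mono
    (ENNReal.mul_ne_top ENNReal.ofReal_ne_top hu.memLp_grad.2.ne) (hC.2 u V hu)
  rwa [ENNReal.toReal_mul, ENNReal.toReal_ofReal hC.1] at this

theorem exists_energy_coercive (hμ : μ ≤ volume) (hp : 1 < p) (hpN : p < N)
    (hh : HasGrowth h p A B) (hC : IsEmbeddingBound μ p C) (hBC : B * C ^ p < 1) :
    ∃ κ c : ℝ, 0 < κ ∧ ∀ u V, HasD1pGradient p u V →
      κ * (∫ x, ‖V x‖ ^ p) - c ≤ energy μ p h u V := by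
  have hp0 : 0 < p := by linarith
  have hC0 := hC.1
  have hA := hh.nonneg_left
  have hB := hh.nonneg_right
  -- Chosen so that absorbing the linear term A|s| costs at most half of the gap 1 - B C^p; the
  -- other half, divided by p, is the coercivity constant.
  set η := (1 - B * C ^ p) / (2 * (p * A * C ^ p + 1)) with hη
  have hη0 : 0 < η := div_pos (by linarith) (by positivity)
  obtain ⟨c, hc, hcη⟩ := exists_rpow_le_add_mul_rpow zero_lt_one hp hη0
  refine ⟨(1 - B * C ^ p) / (2 * p), A * c * μ.real Set.univ, div_pos (by linarith)
    (by positivity), fun u V hu => ?_⟩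
  have mu := hu.memLp_measure hμ hp hpN
  have iu := mu.integrable_norm_rpow_ofReal hp0
  set P := ∫ x, ‖u x‖ ^ p ∂μ with hP
  set D := ∫ x, ‖V x‖ ^ p with hD
  have hD0 : 0 ≤ D := by positivity
  have hPD : P ≤ C ^ p * D := hC.integral_le hμ hp hpN hu
  have h1 : ∫ x, primitive h x (u x) ∂μ ≤ A * c * μ.real Set.univ + (A * η + B / p) * P := by
    have h2 : ∀ x, primitive h x (u x) ≤ A * c + (A * η + B / p) * ‖u x‖ ^ p := by
      intro x
      have h3 := (le_abs_self _).trans (hh.abs_primitive_le hp x (u x))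
      have h4 := mul_le_mul_of_nonneg_left (hcη |u x| (abs_nonneg _)) hA
      rw [Real.rpow_one] at h4
      rw [Real.norm_eq_abs]
      linarith
    refine (integral_mono (hh.integrable_primitive hp mu)
      ((integrable_const _).add (iu.const_mul _)) h2).trans_eq ?_
    rw [integral_add' (integrable_const _) (iu.const_mul _), integral_const, integral_const_mul,
      smul_eq_mul, mul_comm (μ.real Set.univ)]
  have h5 : (A * η + B / p) * P ≤ (A * η + B / p) * (C ^ p * D) := by gcongr
  have h6 : p * A * C ^ p * η ≤ (1 - B * C ^ p) / 2 := by
    have h7 : η * (2 * (p * A * C ^ p + 1)) = 1 - B * C ^ p := by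
      rw [hη]; exact div_mul_cancel₀ _ (by positivity)
    nlinarith
  have h8 : (A * η + B / p) * (C ^ p * D) ≤ D / p - (1 - B * C ^ p) / (2 * p) * D := by
    have h9 : D / p - (1 - B * C ^ p) / (2 * p) * D - (A * η + B / p) * (C ^ p * D) =
        ((1 - B * C ^ p) / 2 - p * A * C ^ p * η) * D / p := by
      field_simp; ring
    have h10 : 0 ≤ ((1 - B * C ^ p) / 2 - p * A * C ^ p * η) * D / p :=
      div_nonneg (mul_nonneg (by linarith) hD0) hp0.le
    linarith
  unfold energy
  linarith

theorem tendsto_energy (hμ : μ ≤ volume) (hp : 1 < p) (hpN : p < N) (hh : HasGrowth h p A B)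
    {φ : ℕ → EuclideanSpace ℝ (Fin N) → ℝ} (hφ : ∀ n, IsTestFun (φ n))
    {u : EuclideanSpace ℝ (Fin N) → ℝ} {V : EuclideanSpace ℝ (Fin N) → EuclideanSpace ℝ (Fin N)}
    (hu : HasD1pGradient p u V)
    (hφu : Tendsto (fun n => eLpNorm (fun x => φ n x - u x)
      (ENNReal.ofReal (criticalExponent N p)) volume) atTop (𝓝 0))
    (hφV : Tendsto (fun n => eLpNorm (fun x => gradient (φ n) x - V x)
      (ENNReal.ofReal p) volume) atTop (𝓝 0)) :
    Tendsto (fun n => energy μ p h (φ n) (gradient (φ n))) atTop (𝓝 (energy μ p h u V)) := by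
  refine Tendsto.sub (Tendsto.div_const ?_ p) ?_
  · exact tendsto_integral_norm_rpow hp.le (fun n => (hφ n).memLp_gradient _) hu.memLp_grad hφV
  · exact hh.tendsto_integral_primitive hp (fun n => (hφ n).memLp _ _)
      (hu.memLp_measure hμ hp hpN) (tendsto_eLpNorm_measure hμ hp hpN hφ hu.memLp.1 hφu)

theorem exists_subseq_cauchy_of_gradient_bounded (hμ : μ ≤ volume) (hp : 1 < p) (hpN : p < N)
    {φ : ℕ → EuclideanSpace ℝ (Fin N) → ℝ} (hφ : ∀ n, IsTestFun (φ n)) {R : ℝ}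
    (hR : ∀ n, ∫ x, ‖gradient (φ n) x‖ ^ p ≤ R) :
    ∃ σ : ℕ → ℕ, StrictMono σ ∧ Tendsto (fun n : ℕ × ℕ =>
      ∫ x, ‖φ (σ n.1) x - φ (σ n.2) x‖ ^ p ∂μ) atTop (𝓝 0) := by
  have hp0 : 0 < p := by linarith
  have hps := lt_criticalExponent hp0 hpN
  obtain ⟨S, hS, hSob⟩ := exists_sobolev_const hp hpN
  set q := criticalExponent N p with hq
  have hq0 : 0 < q := hp0.trans hps
  have hgr : ∀ n, eLpNorm (gradient (φ n)) (ENNReal.ofReal p) volume ^ p ≤ ENNReal.ofReal R := by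
    intro n
    rw [eLpNorm_ofReal_rpow_eq hp0 ((hφ n).memLp_gradient _)]
    exact ENNReal.ofReal_le_ofReal (hR n)
  have hgr' : ∀ n, eLpNorm (gradient (φ n)) (ENNReal.ofReal p) volume ≤
      ENNReal.ofReal R ^ p⁻¹ := fun n => by
    rw [ENNReal.le_rpow_inv_iff hp0]
    exact hgr n
  -- The L^{p*} bound given by Sobolev; the compactness theorem is used with q = p* and one common
  -- bound, hence the maximum below.
  set R₂ : ℝ≥0∞ := (ENNReal.ofReal S * ENNReal.ofReal R ^ p⁻¹) ^ q with hR₂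
  have hR₂t : R₂ ≠ ⊤ := ENNReal.rpow_ne_top_of_nonneg hq0.le (ENNReal.mul_ne_top
    ENNReal.ofReal_ne_top (ENNReal.rpow_ne_top_of_nonneg (by positivity) ENNReal.ofReal_ne_top))
  obtain ⟨σ, hσ, hcau⟩ := exists_subseq_cauchy_eLpNorm hμ hp.le (hp.trans hps).le
    (fun n => (hφ n).contDiff_one) (fun n => (hφ n).2) (R := max (ENNReal.ofReal R) R₂)
    (max_lt ENNReal.ofReal_lt_top hR₂t.lt_top).ne
    (fun n => by
      refine le_trans (le_of_eq ?_) ((hgr n).trans (le_max_left _ _))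
      rw [← lintegral_enorm_rpow_eq hp0]
      refine lintegral_congr fun x => ?_
      rw [← ofReal_norm, ← ofReal_norm, norm_gradient_eq])
    (fun n => by
      rw [lintegral_enorm_rpow_eq hq0]
      refine le_trans ?_ (le_max_right _ _)
      refine ENNReal.rpow_le_rpow ((hSob _ (hφ n)).trans ?_) hq0.le
      gcongr
      exact hgr' n)
  refine ⟨σ, hσ, tendsto_integral_zero_of_eLpNorm hp0
    (f := fun (n : ℕ × ℕ) x => φ (σ n.1) x - φ (σ n.2) x)
    (fun n => ((hφ _).memLp _ _).sub ((hφ _).memLp _ _)) ?_⟩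
  rw [ENNReal.tendsto_nhds_zero]
  intro ε hε
  obtain ⟨M, hM⟩ := hcau ε hε
  exact eventually_atTop.2 ⟨(M, M), fun n hn => hM n.1 hn.1 n.2 hn.2⟩

theorem tendsto_prod_fst_atTop : Tendsto (Prod.fst : ℕ × ℕ → ℕ) atTop atTop := by
  rw [← prod_atTop_atTop_eq]; exact tendsto_fst

theorem tendsto_prod_snd_atTop : Tendsto (Prod.snd : ℕ × ℕ → ℕ) atTop atTop := by
  rw [← prod_atTop_atTop_eq]; exact tendsto_snd

/-- Along an energy-minimizing sequence that is Cauchy in `L^p(μ)`, gradients are Cauchy in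
`L^p`. -/
theorem tendsto_gradient_sub_of_minimizing (hμ : μ ≤ volume) (hp : 1 < p) (hpN : p < N)
    (hh : HasGrowth h p A B) (hC : IsEmbeddingBound μ p C)
    {ψ : ℕ → EuclideanSpace ℝ (Fin N) → ℝ} (hψ : ∀ n, IsTestFun (ψ n)) {R : ℝ}
    (hR : ∀ n, ∫ x, ‖gradient (ψ n) x‖ ^ p ≤ R) {m : ℝ}
    (hm : ∀ φ : EuclideanSpace ℝ (Fin N) → ℝ, IsTestFun φ → m ≤ energy μ p h φ (gradient φ))
    (hψm : Tendsto (fun n => energy μ p h (ψ n) (gradient (ψ n))) atTop (𝓝 m))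
    (hcau : Tendsto (fun n : ℕ × ℕ => ∫ x, ‖ψ n.1 x - ψ n.2 x‖ ^ p ∂μ) atTop (𝓝 0)) :
    Tendsto (fun n : ℕ × ℕ => ∫ x, ‖gradient (ψ n.1) x - gradient (ψ n.2) x‖ ^ p)
      atTop (𝓝 0) := by
  have hp0 : 0 < p := by linarith
  have hC0 : 0 ≤ C := hC.1
  set D : ℕ → ℝ := fun n => ∫ x, ‖gradient (ψ n) x‖ ^ p with hD
  set mid : ℕ × ℕ → EuclideanSpace ℝ (Fin N) → ℝ :=
    fun n x => 1 / 2 * ψ n.1 x + 1 / 2 * ψ n.2 x with hmid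
  have hmt : ∀ n, IsTestFun (mid n) := fun n => (hψ n.1).add_smul (hψ n.2) _ _
  have hmg : ∀ n x, gradient (mid n) x =
      (1 / 2 : ℝ) • (gradient (ψ n.1) x + gradient (ψ n.2) x) := fun n x => by
    rw [hmid, gradient_add_smul (hψ n.1).differentiable (hψ n.2).differentiable, smul_add]
  have hDm : ∀ n : ℕ × ℕ, ∫ x, ‖gradient (mid n) x‖ ^ p ≤ (D n.1 + D n.2) / 2 := by
    intro n
    simp_rw [hmg]
    exact integral_midpoint_le hp ((hψ n.1).memLp_gradient _) ((hψ n.2).memLp_gradient _)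
  have hb : ∀ φ : EuclideanSpace ℝ (Fin N) → ℝ, IsTestFun φ →
      ∫ x, ‖gradient φ x‖ ^ p ≤ R → ∫ x, ‖φ x‖ ^ p ∂μ ≤ C ^ p * R := fun φ hφ hφR =>
    (hC.integral_le hμ hp hpN hφ.hasD1pGradient).trans (by gcongr)
  have hbm : ∀ n, ∫ x, ‖mid n x‖ ^ p ∂μ ≤ C ^ p * R := fun n =>
    hb _ (hmt n) ((hDm n).trans (by linarith [hR n.1, hR n.2]))
  have hhalf : ∀ y : ℝ, ‖1 / 2 * y‖ ^ p = (1 / 2) ^ p * ‖y‖ ^ p := fun y => by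
    rw [norm_mul, Real.mul_rpow (norm_nonneg _) (norm_nonneg _)]; norm_num
  have hlim : Tendsto (fun n : ℕ × ℕ => (1 / 2 : ℝ) ^ p * ∫ x, ‖ψ n.1 x - ψ n.2 x‖ ^ p ∂μ)
      atTop (𝓝 0) := by simpa using hcau.const_mul ((1 / 2 : ℝ) ^ p)
  have t1 := hh.tendsto_integral_primitive_sub hp (μ := μ) (l := atTop)
    (f := fun n : ℕ × ℕ => ψ n.1) (g := mid) (fun n => (hψ n.1).memLp _ _)
    (fun n => (hmt n).memLp _ _) (Eventually.of_forall fun n => hb _ (hψ n.1) (hR n.1))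
    (Eventually.of_forall hbm) (by
      refine hlim.congr fun n => ?_
      rw [← integral_const_mul]
      refine integral_congr_ae (Eventually.of_forall fun x => ?_)
      simp only [hmid]
      rw [← hhalf]
      congr 2
      ring)
  have t2 := hh.tendsto_integral_primitive_sub hp (μ := μ) (l := atTop)
    (f := fun n : ℕ × ℕ => ψ n.2) (g := mid) (fun n => (hψ n.2).memLp _ _)
    (fun n => (hmt n).memLp _ _) (Eventually.of_forall fun n => hb _ (hψ n.2) (hR n.2))
    (Eventually.of_forall hbm) (by
      refine hlim.congr fun n => ?_
      rw [← integral_const_mul]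
      refine integral_congr_ae (Eventually.of_forall fun x => ?_)
      simp only [hmid]
      rw [← hhalf, ← norm_neg]
      congr 2
      ring)
  have e1 := hψm.comp tendsto_prod_fst_atTop
  have e2 := hψm.comp tendsto_prod_snd_atTop
  have t3 : Tendsto (fun n : ℕ × ℕ => p * ((energy μ p h (ψ n.1) (gradient (ψ n.1)) - m) / 2 +
      (energy μ p h (ψ n.2) (gradient (ψ n.2)) - m) / 2 +
      (∫ x, primitive h x (ψ n.1 x) ∂μ - ∫ x, primitive h x (mid n x) ∂μ) / 2 +
      (∫ x, primitive h x (ψ n.2 x) ∂μ - ∫ x, primitive h x (mid n x) ∂μ) / 2)) atTop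
      (𝓝 0) := by
    have e1' := (e1.sub_const m).div_const 2
    have e2' := (e2.sub_const m).div_const 2
    have := (((e1'.add e2').add (t1.div_const 2)).add (t2.div_const 2)).const_mul p
    simpa [Function.comp_def] using this
  -- Because the midpoint is itself a competitor with energy at least m, the convexity defect of the
  -- gradient terms is bounded by the two excesses over m and the changes in the potential term, all
  -- of which tend to 0.
  have hdef : ∀ n : ℕ × ℕ, (D n.1 + D n.2) / 2 - ∫ x, ‖gradient (mid n) x‖ ^ p ≤
      p * ((energy μ p h (ψ n.1) (gradient (ψ n.1)) - m) / 2 +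
      (energy μ p h (ψ n.2) (gradient (ψ n.2)) - m) / 2 +
      (∫ x, primitive h x (ψ n.1 x) ∂μ - ∫ x, primitive h x (mid n x) ∂μ) / 2 +
      (∫ x, primitive h x (ψ n.2 x) ∂μ - ∫ x, primitive h x (mid n x) ∂μ) / 2) := by
    intro n
    have h1 := mul_le_mul_of_nonneg_left (hm _ (hmt n)) hp0.le
    have h2 : p * energy μ p h (mid n) (gradient (mid n)) =
        (∫ x, ‖gradient (mid n) x‖ ^ p) - p * ∫ x, primitive h x (mid n x) ∂μ := by
      unfold energy; field_simp
    have h3 : ∀ k, p * energy μ p h (ψ k) (gradient (ψ k)) =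
        D k - p * ∫ x, primitive h x (ψ k x) ∂μ := by
      intro k; simp only [energy, hD]; field_simp
    have h4 := h3 n.1
    have h5 := h3 n.2
    linarith
  rw [Metric.tendsto_nhds]
  intro η hη
  -- Since D n.1 + D n.2 ≤ 2R, this ε keeps the first term below η / 2; K is then fixed and the
  -- defect term tends to 0.
  obtain ⟨K, hK0, hK⟩ := exists_norm_sub_rpow_le_midpoint_defect (EuclideanSpace ℝ (Fin N)) hp
    (ε := η / (4 * (|R| + 1))) (by positivity)
  have t4 := t3.const_mul K
  rw [mul_zero] at t4
  filter_upwards [t4.eventually (gt_mem_nhds (half_pos hη))] with n hn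
  rw [Real.dist_eq, sub_zero, abs_of_nonneg (by positivity)]
  have h1 := integral_sub_le_midpoint_defect hp ((hψ n.1).memLp_gradient (ENNReal.ofReal p))
    ((hψ n.2).memLp_gradient _) hK
  simp_rw [← hmg] at h1
  have h2 := mul_le_mul_of_nonneg_left (hdef n) hK0
  have h3 : η / (4 * (|R| + 1)) * (D n.1 + D n.2) ≤ η / 2 := by
    calc η / (4 * (|R| + 1)) * (D n.1 + D n.2) ≤ η / (4 * (|R| + 1)) * (2 * (|R| + 1)) := by
          gcongr
          linarith [hR n.1, hR n.2, le_abs_self R]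
      _ = η / 2 := by field_simp; norm_num
  linarith

/-- Minimizing over test functions suffices: the minimizing subsequence converges strongly, so
continuity of the energy replaces weak lower semicontinuity, and the same continuity with density
extends minimality to the whole space. -/
theorem exists_energy_minimizer (hμ : μ ≤ volume) (hp : 1 < p) (hpN : p < N)
    (hh : HasGrowth h p A B) (hC : IsEmbeddingBound μ p C) (hBC : B * C ^ p < 1) :
    ∃ u V, HasD1pGradient p u V ∧
      ∀ v W, HasD1pGradient p v W → energy μ p h u V ≤ energy μ p h v W := by
  have hp0 : 0 < p := by linarith
  obtain ⟨κ, c, hκ, hcoer⟩ := exists_energy_coercive hμ hp hpN hh hC hBC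
  set T : Set ℝ := {e | ∃ φ : EuclideanSpace ℝ (Fin N) → ℝ, IsTestFun φ ∧
    energy μ p h φ (gradient φ) = e} with hT
  have hTn : T.Nonempty := ⟨_, fun _ => 0, ⟨contDiff_const, HasCompactSupport.zero⟩, rfl⟩
  have hTb : BddBelow T := by
    refine ⟨-c, ?_⟩
    rintro e ⟨φ, hφ, rfl⟩
    have h1 := hcoer _ _ hφ.hasD1pGradient
    have h2 : 0 ≤ κ * ∫ x, ‖gradient φ x‖ ^ p := by positivity
    linarith
  set m := sInf T with hm
  have hmle : ∀ φ : EuclideanSpace ℝ (Fin N) → ℝ, IsTestFun φ →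
      m ≤ energy μ p h φ (gradient φ) := fun φ hφ => csInf_le hTb ⟨φ, hφ, rfl⟩
  obtain ⟨e, -, het, heT⟩ := exists_seq_tendsto_sInf hTn hTb
  choose φ hφ hφe using heT
  obtain ⟨b, hb⟩ := het.bddAbove_range
  have hR : ∀ n, ∫ x, ‖gradient (φ n) x‖ ^ p ≤ (b + c) / κ := by
    intro n
    have h1 := hcoer _ _ (hφ n).hasD1pGradient
    have h2 : e n ≤ b := hb ⟨n, rfl⟩
    rw [hφe n] at h1
    rw [le_div_iff₀ hκ]
    linarith
  obtain ⟨σ, hσ, hcau⟩ := exists_subseq_cauchy_of_gradient_bounded hμ hp hpN hφ hR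
  have het' : Tendsto (fun n => energy μ p h (φ (σ n)) (gradient (φ (σ n)))) atTop (𝓝 m) := by
    simp_rw [hφe]
    exact het.comp hσ.tendsto_atTop
  have hgc := tendsto_gradient_sub_of_minimizing hμ hp hpN hh hC (ψ := fun n => φ (σ n))
    (fun n => hφ _) (fun n => hR _) hmle het' hcau
  obtain ⟨u, V, huV, hu, hV⟩ := exists_hasD1pGradient_of_cauchy hp hpN
    (φ := fun n => φ (σ n)) (fun n => hφ _)
    (tendsto_eLpNorm_zero_of_integral hp0
      (f := fun (n : ℕ × ℕ) x => gradient (φ (σ n.1)) x - gradient (φ (σ n.2)) x)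
      (fun n => ((hφ _).memLp_gradient _).sub ((hφ _).memLp_gradient _)) hgc)
  refine ⟨u, V, huV, fun v W hvW => ?_⟩
  have h1 := tendsto_nhds_unique
    (tendsto_energy hμ hp hpN hh (fun n => hφ (σ n)) huV hu hV) het'
  rw [h1]
  obtain ⟨ψ, hψ, hψv, hψW⟩ := hvW.approx
  exact ge_of_tendsto' (tendsto_energy hμ hp hpN hh hψ hvW hψv hψW) fun n => hmle _ (hψ n)

end Minimization

/-! ### First variation of the energy. -/

noncomputable section EulerLagrange

/-- Differentiation under the integral: for |t| < 1 the derivative of the integrand is dominated by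
p(‖V‖ + ‖Φ‖)^p. Since p > 1, ‖·‖^p is differentiable at the origin too. -/
theorem hasDerivAt_integral_norm_add_smul_rpow {X F : Type*} [MeasurableSpace X] {μ : Measure X}
    [NormedAddCommGroup F] [InnerProductSpace ℝ F] {p : ℝ} (hp : 1 < p) {V Φ : X → F}
    (hV : MemLp V (ENNReal.ofReal p) μ) (hΦ : MemLp Φ (ENNReal.ofReal p) μ) :
    Integrable (fun x => p * inner ℝ (‖V x‖ ^ (p - 2) • V x) (Φ x)) μ ∧
      HasDerivAt (fun t : ℝ => ∫ x, ‖V x + t • Φ x‖ ^ p ∂μ)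
        (∫ x, p * inner ℝ (‖V x‖ ^ (p - 2) • V x) (Φ x) ∂μ) 0 := by
  have hp0 : 0 < p := by linarith
  have hm : ∀ t : ℝ, MemLp (fun x => V x + t • Φ x) (ENNReal.ofReal p) μ := fun t =>
    hV.add (hΦ.const_smul t)
  have hb : Integrable (fun x => p * ‖‖V x‖ + ‖Φ x‖‖ ^ p) μ :=
    ((hV.norm.add hΦ.norm).integrable_norm_rpow_ofReal hp0).const_mul p
  have key := hasDerivAt_integral_of_dominated_loc_of_deriv_le (μ := μ) (x₀ := (0 : ℝ))
    (s := Metric.ball 0 1) (F := fun t x => ‖V x + t • Φ x‖ ^ p)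
    (F' := fun t x => p * inner ℝ (‖V x + t • Φ x‖ ^ (p - 2) • (V x + t • Φ x)) (Φ x))
    (bound := fun x => p * ‖‖V x‖ + ‖Φ x‖‖ ^ p) (Metric.ball_mem_nhds _ one_pos)
    (Eventually.of_forall fun t => ((hm t).integrable_norm_rpow_ofReal hp0).1)
    ((hm 0).integrable_norm_rpow_ofReal hp0) ?_ ?_ hb ?_
  · simpa using key
  · have h0 := (hm 0).1
    exact (((h0.norm.aemeasurable.pow_const (p - 2)).aestronglyMeasurable.smul h0).inner
      hΦ.1).const_mul p
  · refine Eventually.of_forall fun x t ht => ?_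
    have ht1 : |t| ≤ 1 := by simpa using (mem_ball_zero_iff.1 ht).le
    set y := V x + t • Φ x with hy
    have hyn : ‖y‖ ≤ ‖V x‖ + ‖Φ x‖ := by
      refine (norm_add_le _ _).trans ?_
      gcongr
      rw [norm_smul, Real.norm_eq_abs]
      exact mul_le_of_le_one_left (norm_nonneg _) ht1
    -- The exponent p - 2 may be negative; at y = 0 the extra factor ‖y‖ makes the left side 0
    -- whatever value 0 ^ (p - 2) receives.
    have h1 : ‖y‖ ^ (p - 2) * ‖y‖ ≤ ‖y‖ ^ (p - 1) := by
      rcases (norm_nonneg y).eq_or_lt with h | h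
      · rw [← h, mul_zero]; positivity
      · rw [← Real.rpow_add_one h.ne']; ring_nf; exact le_rfl
    have hs : 0 ≤ ‖V x‖ + ‖Φ x‖ := by positivity
    rw [norm_mul, Real.norm_of_nonneg hp0.le, Real.norm_of_nonneg hs]
    refine mul_le_mul_of_nonneg_left ?_ hp0.le
    calc ‖(inner ℝ (‖y‖ ^ (p - 2) • y) (Φ x) : ℝ)‖ ≤ ‖‖y‖ ^ (p - 2) • y‖ * ‖Φ x‖ :=
          norm_inner_le_norm _ _
      _ = ‖y‖ ^ (p - 2) * ‖y‖ * ‖Φ x‖ := by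
          rw [norm_smul, Real.norm_of_nonneg (by positivity)]
      _ ≤ ‖y‖ ^ (p - 1) * ‖Φ x‖ := by gcongr
      _ ≤ (‖V x‖ + ‖Φ x‖) ^ (p - 1) * (‖V x‖ + ‖Φ x‖) := by
          gcongr
          linarith [norm_nonneg (V x)]
      _ = (‖V x‖ + ‖Φ x‖) ^ p := by
          rcases hs.eq_or_lt with h | h
          · rw [← h, mul_zero, Real.zero_rpow hp0.ne']
          · rw [← Real.rpow_add_one h.ne']; ring_nf
  · refine Eventually.of_forall fun x t _ => ?_
    have h1 : HasDerivAt (fun t : ℝ => V x + t • Φ x) (Φ x) t := by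
      simpa using ((hasDerivAt_id t).smul_const (Φ x)).const_add (V x)
    have h2 := (hasFDerivAt_norm_rpow (V x + t • Φ x) hp).comp_hasDerivAt t h1
    refine h2.congr_deriv ?_
    rw [real_inner_smul_left, smul_apply, innerSL_apply_apply, smul_eq_mul,
      mul_assoc]

theorem HasGrowth.hasDerivAt_integral_primitive {X : Type*} [MeasurableSpace X] {μ : Measure X}
    [IsFiniteMeasure μ] {h : X → ℝ → ℝ} {p A B : ℝ} (hh : HasGrowth h p A B) (hp : 1 < p)
    {u φ : X → ℝ} (hu : MemLp u (ENNReal.ofReal p) μ) (hφ : MemLp φ (ENNReal.ofReal p) μ) :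
    Integrable (fun x => h x (u x) * φ x) μ ∧
      HasDerivAt (fun t : ℝ => ∫ x, primitive h x (u x + t * φ x) ∂μ)
        (∫ x, h x (u x) * φ x ∂μ) 0 := by
  have hp0 : 0 < p := by linarith
  have hB := hh.nonneg_right
  have hm : ∀ t : ℝ, MemLp (fun x => u x + t * φ x) (ENNReal.ofReal p) μ := fun t =>
    hu.add (hφ.const_mul t)
  have hb : Integrable (fun x => A * ‖φ x‖ + B * ‖‖u x‖ + ‖φ x‖‖ ^ p) μ :=
    ((hφ.integrable (by simpa using hp.le)).norm.const_mul A).add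
      (((hu.norm.add hφ.norm).integrable_norm_rpow_ofReal hp0).const_mul B)
  have key := hasDerivAt_integral_of_dominated_loc_of_deriv_le (μ := μ) (x₀ := (0 : ℝ))
    (s := Metric.ball 0 1) (F := fun t x => primitive h x (u x + t * φ x))
    (F' := fun t x => h x (u x + t * φ x) * φ x)
    (bound := fun x => A * ‖φ x‖ + B * ‖‖u x‖ + ‖φ x‖‖ ^ p) (Metric.ball_mem_nhds _ one_pos)
    (Eventually.of_forall fun t => (hh.integrable_primitive hp (hm t)).1)
    (hh.integrable_primitive hp (hm 0)) ?_ ?_ hb ?_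
  · simpa using key
  · exact (hh.aemeasurable_comp (hm 0).1.aemeasurable).aestronglyMeasurable.mul hφ.1
  · refine Eventually.of_forall fun x t ht => ?_
    have ht1 : |t| ≤ 1 := by simpa using (mem_ball_zero_iff.1 ht).le
    set y := u x + t * φ x with hy
    have hyn : |y| ≤ ‖u x‖ + ‖φ x‖ := by
      refine (abs_add_le _ _).trans ?_
      rw [abs_mul]
      exact add_le_add le_rfl (mul_le_of_le_one_left (abs_nonneg _) ht1)
    have hs : 0 ≤ ‖u x‖ + ‖φ x‖ := by positivity
    have h2 : |y| ^ (p - 1) * ‖φ x‖ ≤ (‖u x‖ + ‖φ x‖) ^ p := by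
      calc |y| ^ (p - 1) * ‖φ x‖ ≤ (‖u x‖ + ‖φ x‖) ^ (p - 1) * (‖u x‖ + ‖φ x‖) := by
            gcongr
            linarith [norm_nonneg (u x)]
        _ = (‖u x‖ + ‖φ x‖) ^ p := by
            rcases hs.eq_or_lt with h | h
            · rw [← h, mul_zero, Real.zero_rpow hp0.ne']
            · rw [← Real.rpow_add_one h.ne']; ring_nf
    rw [norm_mul, Real.norm_of_nonneg hs]
    calc ‖h x y‖ * ‖φ x‖ ≤ (A + B * |y| ^ (p - 1)) * ‖φ x‖ :=
          mul_le_mul_of_nonneg_right (hh.abs_le x y) (norm_nonneg _)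
      _ = A * ‖φ x‖ + B * (|y| ^ (p - 1) * ‖φ x‖) := by ring
      _ ≤ _ := by gcongr
  · refine Eventually.of_forall fun x t _ => ?_
    have h1 : HasDerivAt (fun t : ℝ => u x + t * φ x) (φ x) t := by
      simpa using ((hasDerivAt_id t).mul_const (φ x)).const_add (u x)
    exact (hh.hasDerivAt_primitive x _).comp t h1

/-- A minimizer of the energy satisfies the Euler-Lagrange equation. -/
theorem eulerLagrange_of_minimizer {N : ℕ} {μ : Measure (EuclideanSpace ℝ (Fin N))}
    [IsFiniteMeasure μ] {p : ℝ} {h : EuclideanSpace ℝ (Fin N) → ℝ → ℝ} {A B : ℝ}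
    (hμ : μ ≤ volume) (hp : 1 < p) (hpN : p < N) (hh : HasGrowth h p A B)
    {u φ : EuclideanSpace ℝ (Fin N) → ℝ}
    {V Φ : EuclideanSpace ℝ (Fin N) → EuclideanSpace ℝ (Fin N)}
    (hu : HasD1pGradient p u V) (hφ : HasD1pGradient p φ Φ)
    (hmin : ∀ v W, HasD1pGradient p v W → energy μ p h u V ≤ energy μ p h v W) :
    Integrable (fun x => inner ℝ (‖V x‖ ^ (p - 2) • V x) (Φ x)) volume ∧
      Integrable (fun x => h x (u x) * φ x) μ ∧
      ∫ x, inner ℝ (‖V x‖ ^ (p - 2) • V x) (Φ x) = ∫ x, h x (u x) * φ x ∂μ := by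
  have hp0 : 0 < p := by linarith
  obtain ⟨i1, d1⟩ := hasDerivAt_integral_norm_add_smul_rpow hp hu.memLp_grad hφ.memLp_grad
  obtain ⟨i2, d2⟩ := hh.hasDerivAt_integral_primitive hp (hu.memLp_measure hμ hp hpN)
    (hφ.memLp_measure hμ hp hpN)
  have d3 := (d1.div_const p).sub d2
  have hloc : IsLocalMin ((fun t : ℝ => (∫ x, ‖V x + t • Φ x‖ ^ p) / p) -
      fun t : ℝ => ∫ x, primitive h x (u x + t * φ x) ∂μ) 0 := by
    refine Eventually.of_forall fun t => ?_
    have := hmin _ _ (hu.add_smul hp hpN hφ t)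
    simpa [energy] using this
  have h0 := hloc.hasDerivAt_eq_zero d3
  rw [integral_const_mul, mul_div_cancel_left₀ _ hp0.ne'] at h0
  refine ⟨?_, i2, sub_eq_zero.1 h0⟩
  have := i1.const_mul p⁻¹
  simpa [← mul_assoc, inv_mul_cancel₀ hp0.ne'] using this

end EulerLagrange

/-! ### Reduction of the original equation to the weighted variational problem. -/

section WeightedProblem

/-- Carathéodory data become jointly measurable after being set to 0 on one null set: off it, k
agrees with measurable versions at all rational s, and continuity in s carries measurability to real
s and then to the pair (x, s). -/
theorem exists_hasGrowth_ae_eq {X : Type*} [MeasurableSpace X] {μ : Measure X}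
    {k : X → ℝ → ℝ} {p A B : ℝ} (hm : ∀ s, AEMeasurable (fun x => k x s) μ)
    (hc : ∀ᵐ x ∂μ, Continuous (k x)) (hA : 0 ≤ A) (hB : 0 ≤ B)
    (hb : ∀ᵐ x ∂μ, ∀ s, |k x s| ≤ A + B * |s| ^ (p - 1)) :
    ∃ h : X → ℝ → ℝ, HasGrowth h p A B ∧ ∀ᵐ x ∂μ, ∀ s, h x s = k x s := by
  classical
  have hq : ∀ᵐ x ∂μ, ∀ r : ℚ, k x r = (hm r).mk _ x := ae_all_iff.2 fun r => (hm r).ae_eq_mk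
  have hall := hc.and (hb.and hq)
  obtain ⟨t, ht, htm, ht0⟩ := exists_measurable_superset_of_null (ae_iff.1 hall)
  have hgood : ∀ x, x ∉ t → Continuous (k x) ∧ (∀ s, |k x s| ≤ A + B * |s| ^ (p - 1)) ∧
      ∀ r : ℚ, k x r = (hm r).mk _ x := fun x hx => by
    by_contra hcon
    exact hx (ht hcon)
  refine ⟨fun x s => if x ∈ t then 0 else k x s, ⟨?_, fun x => ?_, hA, hB, fun x s => ?_⟩, ?_⟩
  · have hcont : ∀ x, Continuous fun s => if x ∈ t then (0 : ℝ) else k x s := by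
      intro x
      by_cases hx : x ∈ t
      · simpa [hx] using continuous_const
      · simpa [hx] using (hgood x hx).1
    have hrat : ∀ r : ℚ, Measurable fun x => if x ∈ t then (0 : ℝ) else k x r := by
      intro r
      have h1 : (fun x => if x ∈ t then (0 : ℝ) else k x r) =
          fun x => if x ∈ t then (0 : ℝ) else (hm r).mk _ x := by
        ext x
        by_cases hx : x ∈ t
        · simp [hx]
        · simp only [hx, if_false]
          exact (hgood x hx).2.2 r
      rw [h1]
      exact Measurable.ite htm measurable_const (hm r).measurable_mk
    have hreal : ∀ s : ℝ, Measurable fun x => if x ∈ t then (0 : ℝ) else k x s := by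
      intro s
      obtain ⟨r, -, -, hr⟩ := Real.exists_seq_rat_strictMono_tendsto s
      exact measurable_of_tendsto_metrizable (fun n => hrat (r n))
        (tendsto_pi_nhds.2 fun x => ((hcont x).tendsto s).comp hr)
    exact (measurable_uncurry_of_continuous_of_measurable
      (u := fun (s : ℝ) x => if x ∈ t then (0 : ℝ) else k x s) hcont hreal).comp measurable_swap
  · by_cases hx : x ∈ t
    · simpa [hx] using continuous_const
    · simpa [hx] using (hgood x hx).1
  · by_cases hx : x ∈ t
    · simp only [hx, if_true, abs_zero]
      positivity
    · simpa only [hx, if_false] using (hgood x hx).2.1 s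
  · filter_upwards [measure_eq_zero_iff_ae_notMem.1 ht0] with x hx s
    simp [hx]

variable {N : ℕ} {α : ℝ}

theorem weight_pos (x : EuclideanSpace ℝ (Fin N)) : 0 < weight N α x := by
  unfold weight; positivity

theorem weight_le_one (x : EuclideanSpace ℝ (Fin N)) : weight N α x ≤ 1 := by
  unfold weight
  rw [div_le_one (by positivity)]
  linarith [show 0 ≤ ‖x‖ ^ ((N : ℝ) + α) by positivity]

theorem measurable_weight : Measurable (weight N α) := by
  unfold weight
  fun_prop

/-- Comparison with (1 + ‖x‖)^(-(N+α)), integrable because N + α exceeds the dimension. -/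
theorem integrable_weight (hα : 0 < α) : Integrable (weight N α) volume := by
  set r := (N : ℝ) + α with hr
  have hr0 : 0 < r := by positivity
  have h1 : Integrable (fun x : EuclideanSpace ℝ (Fin N) => 2 ^ r * (1 + ‖x‖) ^ (-r)) volume :=
    (integrable_one_add_norm (by rw [finrank_euclideanSpace_fin]; linarith)).const_mul _
  refine h1.mono' measurable_weight.aestronglyMeasurable (Eventually.of_forall fun x => ?_)
  rw [Real.norm_of_nonneg (weight_pos x).le, Real.rpow_neg (by positivity), ← div_eq_mul_inv]
  unfold weight
  rw [div_le_div_iff₀ (by positivity) (by positivity), one_mul, ← hr]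
  have h2 : 1 + ‖x‖ ≤ 2 * max 1 ‖x‖ := by linarith [le_max_left 1 ‖x‖, le_max_right 1 ‖x‖]
  calc (1 + ‖x‖) ^ r ≤ (2 * max 1 ‖x‖) ^ r := Real.rpow_le_rpow (by positivity) h2 hr0.le
    _ = 2 ^ r * (max 1 ‖x‖) ^ r := Real.mul_rpow (by norm_num) (by positivity)
    _ ≤ 2 ^ r * (1 + ‖x‖ ^ r) := by
        gcongr
        have : 0 ≤ ‖x‖ ^ r := by positivity
        rcases max_choice 1 ‖x‖ with h | h <;> rw [h]
        · rw [Real.one_rpow]; linarith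
        · linarith

theorem isFiniteMeasure_weightMeasure (hα : 0 < α) : IsFiniteMeasure (weightMeasure N α) :=
  isFiniteMeasure_withDensity_ofReal (integrable_weight hα).2

theorem weightMeasure_le_volume : weightMeasure N α ≤ volume := by
  calc weightMeasure N α ≤ volume.withDensity 1 :=
        withDensity_mono (Eventually.of_forall fun x => by
          simpa using weight_le_one x)
    _ = volume := withDensity_one

theorem weightedEmbeddingNorm_eq (p : ℝ) : weightedEmbeddingNorm N p α =
    sInf {C | IsEmbeddingBound (weightMeasure N α) p C} := rfl

/-- Subcritical growth constants: both hypotheses on `g` yield growth `p - 1` with a leading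
constant below the threshold given by the embedding. -/
theorem exists_growth_constants {p ca cg : ℝ} (hp : 1 < p) (hpN : p < N) (hca : 0 < ca)
    (hα : 0 < α) (hcg : 0 < cg) {g : EuclideanSpace ℝ (Fin N) → ℝ → ℝ}
    (hgrowth :
      (∃ q : ℝ, 1 < q ∧ q < p ∧
        ∀ᵐ x ∂volume, ∀ s : ℝ, |g x s| ≤ cg * (1 + |s| ^ (q - 1))) ∨
      ((∀ᵐ x ∂volume, ∀ s : ℝ, |g x s| ≤ cg * (1 + |s| ^ (p - 1))) ∧
        ca * cg < 1 / weightedEmbeddingNorm N p α ^ p)) :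
    ∃ A B C : ℝ, 0 ≤ A ∧ 0 ≤ B ∧ IsEmbeddingBound (weightMeasure N α) p C ∧
      ca * B * C ^ p < 1 ∧ ∀ᵐ x ∂volume, ∀ s : ℝ, |g x s| ≤ A + B * |s| ^ (p - 1) := by
  have hp0 : 0 < p := by linarith
  have := isFiniteMeasure_weightMeasure (N := N) hα
  obtain ⟨C₀, hC₀⟩ : ∃ C, IsEmbeddingBound (weightMeasure N α) p C :=
    exists_embedding_const weightMeasure_le_volume hp hpN
  rcases hgrowth with ⟨q, hq1, hqp, hg⟩ | ⟨hg, hlt⟩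
  · have hC0 := hC₀.1
    -- Makes ca · (cg η) · C₀^p equal to C₀^p / (2(C₀^p + 1)) < 1; the summand 1 covers C₀ = 0.
    set η := 1 / (2 * (ca * cg * (C₀ ^ p + 1))) with hη
    have hη0 : 0 < η := by positivity
    obtain ⟨c, hc, hcη⟩ := exists_rpow_le_add_mul_rpow (r := q - 1) (s := p - 1) (by linarith)
      (by linarith) hη0
    refine ⟨cg * (1 + c), cg * η, C₀, by positivity, by positivity, hC₀, ?_, ?_⟩
    · have h1 : ca * (cg * η) * C₀ ^ p = C₀ ^ p / (2 * (C₀ ^ p + 1)) := by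
        rw [hη]; field_simp
      rw [h1, div_lt_one (by positivity)]
      linarith [show 0 ≤ C₀ ^ p by positivity]
    · filter_upwards [hg] with x hx s
      refine (hx s).trans ?_
      have := mul_le_mul_of_nonneg_left (hcη |s| (abs_nonneg s)) hcg.le
      linarith
  · set S := {C | IsEmbeddingBound (weightMeasure N α) p C} with hS
    rw [weightedEmbeddingNorm_eq, ← hS] at hlt
    set W := sInf S with hW
    have hW0 : 0 ≤ W := Real.sInf_nonneg fun C hC => hC.1
    have h1 : ca * cg * W ^ p < 1 := by
      -- When W = 0, where 1 / W ^ p is 0 by convention, the claim is just 0 < 1.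
      rcases hW0.eq_or_lt with h | h
      · rw [← h, Real.zero_rpow hp0.ne']; simp
      · rwa [lt_div_iff₀ (by positivity)] at hlt
    -- Attainment of the infimum W is not needed: the inequality is strict, so by continuity it
    -- persists for some embedding bound C slightly above W.
    have hcont : Continuous fun C : ℝ => ca * cg * C ^ p :=
      continuous_const.mul (Real.continuous_rpow_const hp0.le)
    obtain ⟨δ, hδ, hδb⟩ := Metric.eventually_nhds_iff.1
      ((hcont.tendsto W).eventually (gt_mem_nhds h1))
    obtain ⟨C, hCS, hCW⟩ := exists_lt_of_csInf_lt ⟨C₀, hC₀⟩ (show sInf S < W + δ by linarith)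
    have hWC : W ≤ C := csInf_le ⟨0, fun C hC => hC.1⟩ hCS
    refine ⟨cg, cg, C, hcg.le, hcg.le, hCS, hδb ?_, ?_⟩
    · rw [Real.dist_eq, abs_of_nonneg (by linarith)]; linarith
    · filter_upwards [hg] with x hx s
      linarith [hx s]

theorem integrable_weightMeasure_iff {f : EuclideanSpace ℝ (Fin N) → ℝ} :
    Integrable f (weightMeasure N α) ↔ Integrable (fun x => weight N α x * f x) volume := by
  unfold weightMeasure
  rw [integrable_withDensity_iff_integrable_smul' measurable_weight.ennreal_ofReal
    (Eventually.of_forall fun _ => ENNReal.ofReal_lt_top)]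
  simp_rw [fun x => ENNReal.toReal_ofReal (weight_pos (N := N) (α := α) x).le, smul_eq_mul]

theorem integral_weightMeasure (f : EuclideanSpace ℝ (Fin N) → ℝ) :
    ∫ x, f x ∂weightMeasure N α = ∫ x, weight N α x * f x := by
  unfold weightMeasure
  rw [integral_withDensity_eq_integral_toReal_smul measurable_weight.ennreal_ofReal
    (Eventually.of_forall fun _ => ENNReal.ofReal_lt_top)]
  simp_rw [fun x => ENNReal.toReal_ofReal (weight_pos (N := N) (α := α) x).le, smul_eq_mul]

end WeightedProblem

theorem theorem3p6 (N : ℕ) (p : ℝ) (hp : 1 < p) (hpN : p < N)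
    (a : EuclideanSpace ℝ (Fin N) → ℝ) (ha_meas : AEMeasurable a volume)
    (ca α : ℝ) (hca : 0 < ca) (hα : 0 < α)
    (ha : ∀ᵐ x ∂volume, |a x| ≤ ca * (1 / (1 + ‖x‖ ^ ((N : ℝ) + α))))
    (g : EuclideanSpace ℝ (Fin N) → ℝ → ℝ) (hg : IsCaratheodoryFun g)
    (cg : ℝ) (hcg : 0 < cg)
    (hgrowth :
      (∃ q : ℝ, 1 < q ∧ q < p ∧
        ∀ᵐ x ∂volume, ∀ s : ℝ, |g x s| ≤ cg * (1 + |s| ^ (q - 1))) ∨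
      ((∀ᵐ x ∂volume, ∀ s : ℝ, |g x s| ≤ cg * (1 + |s| ^ (p - 1))) ∧
        ca * cg < 1 / weightedEmbeddingNorm N p α ^ p)) :
    ∃ u : EuclideanSpace ℝ (Fin N) → ℝ,
      IsWeakPLaplaceSolution p (fun x s => a x * g x s) u := by
  have hfin := isFiniteMeasure_weightMeasure (N := N) hα
  have hle := weightMeasure_le_volume (N := N) (α := α)
  obtain ⟨A, B, C, hA, hB, hC, hBC, hgb⟩ := exists_growth_constants hp hpN hca hα hcg hgrowth
  -- Relative to the measure w dx the right-hand side has density (a/w) g, and |a/w| ≤ ca turns the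
  -- growth constants A, B of g into ca A, ca B.
  obtain ⟨h, hh, hk⟩ := exists_hasGrowth_ae_eq (μ := volume)
    (k := fun x s => a x / weight N α x * g x s) (p := p) (A := ca * A) (B := ca * B)
    (fun s => (ha_meas.div measurable_weight.aemeasurable).mul (hg.measurable s))
    (hg.continuous.mono fun x hx => continuous_const.mul hx) (by positivity) (by positivity) (by
      filter_upwards [ha, hgb] with x hax hgx s
      have h1 : |a x / weight N α x| ≤ ca := by
        rw [abs_div, abs_of_pos (weight_pos x), div_le_iff₀ (weight_pos x)]
        exact hax
      rw [abs_mul]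
      calc |a x / weight N α x| * |g x s| ≤ ca * (A + B * |s| ^ (p - 1)) :=
            mul_le_mul h1 (hgx s) (abs_nonneg _) hca.le
        _ = _ := by ring)
  obtain ⟨u, V, huV, hmin⟩ := exists_energy_minimizer hle hp hpN hh hC hBC
  refine ⟨u, V, huV, fun φ Φ hφ => ?_⟩
  obtain ⟨i1, i2, heq⟩ := eulerLagrange_of_minimizer hle hp hpN hh huV hφ hmin
  have hae : (fun x => weight N α x * (h x (u x) * φ x)) =ᵐ[volume]
      fun x => a x * g x (u x) * φ x := by
    filter_upwards [hk] with x hx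
    have := (weight_pos (N := N) (α := α) x).ne'
    rw [hx]
    field_simp
  rw [integrable_weightMeasure_iff] at i2
  rw [integral_weightMeasure] at heq
  exact ⟨i1, i2.congr hae, heq.trans (integral_congr_ae hae)⟩
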